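/- Let $1<p<2$, let $q\ge p$ satisfy $\theta:=\frac1p+\frac1q>1$, let $T>0$, and let $\omega:[0,T]\to\mathbb R$ be continuous with finite $p$-variation. For a path $x$ on $[a,b]$ with values in a normed space write $$|||x|||_{p\text{-var},[a,b]}:=\Big(\sup_{\Pi}\sum_{i=0}^{n-1}\|x(t_{i+1})-x(t_i)\|^p\Big)^{1/p},$$ where the supremum is over all finite partitions $\Pi=\{a=t_0<t_1<\dots<t_n=b\}$. Let $A,C\in\mathbb R^{d\times d}$, and suppose that $A$ is negative definite: there is a constant $h_A>0$ with $$\langle x,Ax\rangle\le -h_A\|x\|^2\qquad\text{for all }x\in\mathbb R^d .$$ Consider the linear Young equation $$dz(t)=Az(t)\,dt+Cz(t)\,d\omega(t),$$ and let $\Phi(\cdot,\omega):[0,T]\to\mathbb R^{d\times d}$ be its fundamental matrix with $\Phi(0,\omega)=\mathrm{Id}$, that is, a continuous matrix path of finite $q$-variation with $$\Phi(t,\omega)=\mathrm{Id}+\int_0^tA\Phi(s,\omega)\,ds+\int_0^tC\Phi(s,\omega)\,d\omega(s)\qquad\text{for all }t\in[0,T],$$ where the last integral is the Young integral, i.e.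 the limit of the left-point Riemann–Stieltjes sums as the mesh of the partition tends to $0$. Then for every $\delta>0$ and every $t\in[0,1]$ with $t\le T$, $$\|\Phi(t,\omega)\|\le\exp\Big\{-h_At+\delta+\max\{\|C\|,\|C\|^p\}\,\kappa(t,\omega)\Big\},$$ where $\|\cdot\|$ denotes the Euclidean norm on $\mathbb R^d$ and the induced operator norm on matrices, $$K:=(1-2^{1-\theta})^{-1},\qquad G:=\max\big\{8\|A\|,\;16K\|C\|,\;8^p\|A\|^p,\;16^pK^p\|C\|^p\big\},$$ and $$\kappa(t,\omega):=\frac1{\delta^{p-1}}|||\omega|||^p_{p\text{-var},[0,t]}+4KG\,|||\omega|||_{p\text{-var},[0,t]}\Big(t+|||\omega|||_{p\text{-var},[0,t]}+|||\omega|||^p_{p\text{-var},[0,t]}\Big).$$ -/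

import Mathlib

open scoped ENNReal Matrix.Norms.L2Operator

noncomputable section

namespace Young

/-- A finite partition `a = t₀ < t₁ < ⋯ < tₙ = b` of the interval `[a, b]`.
Only the values `pt 0, …, pt n` are relevant. -/
structure Partition (a b : ℝ) where
  n : ℕ
  pt : ℕ → ℝ
  pt_zero : pt 0 = a
  pt_last : pt n = b
  lt_succ : ∀ i < n, pt i < pt (i + 1)

/-- The `p`-variation seminorm
`(sup_Π ∑ ‖x(tᵢ₊₁) - x(tᵢ)‖ ^ p) ^ (1 / p)` of `x` on `[a, b]`, with values in `[0, ∞]`. -/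
def ePVar {E : Type*} [NormedAddCommGroup E] (p : ℝ) (x : ℝ → E) (a b : ℝ) : ℝ≥0∞ :=
  (⨆ π : Partition a b,
    ∑ i ∈ Finset.range π.n, ENNReal.ofReal (‖x (π.pt (i + 1)) - x (π.pt i)‖ ^ p)) ^ (1 / p)

/-- The `p`-variation seminorm as a real number (meaningful when it is finite). -/
def pVar {E : Type*} [NormedAddCommGroup E] (p : ℝ) (x : ℝ → E) (a b : ℝ) : ℝ :=
  (ePVar p x a b).toReal

/-- The space of continuous paths of finite `p`-variation on `[a, b]`. -/
def MemCPVar {E : Type*} [NormedAddCommGroup E] (p : ℝ) (x : ℝ → E) (a b : ℝ) : Prop :=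
  ContinuousOn x (Set.Icc a b) ∧ ePVar p x a b < ⊤

/-- `HasIntegral x ω a b I`: the Young integral `∫_a^b x(s) dω(s)` exists and equals `I`, that is,
the left-point sums `∑ x(tᵢ) (ω(tᵢ₊₁) - ω(tᵢ))` converge to `I` as the mesh of the partition of
`[a, b]` tends to zero. -/
def HasIntegral {E : Type*} [NormedAddCommGroup E] [NormedSpace ℝ E]
    (x : ℝ → E) (ω : ℝ → ℝ) (a b : ℝ) (I : E) : Prop :=
  ∀ ε > 0, ∃ η > 0, ∀ π : Partition a b,
    (∀ i < π.n, π.pt (i + 1) - π.pt i < η) →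
      ‖∑ i ∈ Finset.range π.n, (ω (π.pt (i + 1)) - ω (π.pt i)) • x (π.pt i) - I‖ < ε

/-- `Φ` is the fundamental matrix on `[0, T]` of the linear Young equation
`dz(t) = A z(t) dt + C z(t) dω(t)`: a continuous matrix path of finite `q`-variation with
`Φ(0) = Id` and `Φ(t) = Φ(0) + ∫_0^t A Φ(s) ds + ∫_0^t C Φ(s) dω(s)` for all `t ∈ [0, T]`. -/
structure IsFundamentalMatrix {d : ℕ} (q T : ℝ) (A C : Matrix (Fin d) (Fin d) ℝ) (ω : ℝ → ℝ)
    (Φ : ℝ → Matrix (Fin d) (Fin d) ℝ) : Prop where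
  memCPVar : MemCPVar q Φ 0 T
  init : Φ 0 = 1
  eqn : ∀ t ∈ Set.Icc 0 T,
    HasIntegral (fun s => C * Φ s) ω 0 t (Φ t - Φ 0 - ∫ s in (0 : ℝ)..t, A * Φ s)

/-- The constant `K = (1 - 2 ^ (1 - θ))⁻¹` with `θ = 1 / p + 1 / q`. -/
def constK (p q : ℝ) : ℝ := (1 - (2 : ℝ) ^ (1 - (1 / p + 1 / q)))⁻¹

/-- The constant `G = max {8‖A‖, 16K‖C‖, 8^p ‖A‖^p, 16^p K^p ‖C‖^p}`, with operator norms. -/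
def constG {d : ℕ} (p q : ℝ) (A C : Matrix (Fin d) (Fin d) ℝ) : ℝ :=
  max (max (8 * ‖A‖) (16 * constK p q * ‖C‖))
    (max ((8 : ℝ) ^ p * ‖A‖ ^ p) ((16 : ℝ) ^ p * constK p q ^ p * ‖C‖ ^ p))

/-- The function `κ(t, ω)`. -/
def kappa {d : ℕ} (p q δ : ℝ) (A C : Matrix (Fin d) (Fin d) ℝ) (ω : ℝ → ℝ) (t : ℝ) : ℝ :=
  1 / δ ^ (p - 1) * pVar p ω 0 t ^ p +
    4 * constK p q * constG p q A C * pVar p ω 0 t *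
      (t + pVar p ω 0 t + pVar p ω 0 t ^ p)

end Young

end

/-!
For a vector `x`, the path `z t = Φ t x` is estimated in polar coordinates. Where `z` does not
vanish, `y = z / ‖z‖` satisfies, to first order,
`d log ‖z‖ = ⟨y, A y⟩ dt + ⟨y, C y⟩ dω` and `dy = (A y - ⟨y, A y⟩ y) dt + (C y - ⟨y, C y⟩ y) dω`.
The first term of `d log ‖z‖` is at most `-h_A dt`. By the Young–Loève estimate, the second one
integrates to at most `‖C‖ * |||ω||| + K * |||⟨y, C y⟩||| * |||ω|||`, so the point is to bound the
`q`-variation of `y`.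

The chain rule is avoided by working with Euler steps over a fine partition. Variations are encoded
by controls (`IsPControl`): functions `f u v` of an interval whose `p`-th power is superadditive.

* `norm_sum_sub_le_of_defect_le` is the discrete Young–Loève estimate for two controls. Its constant
  is `∑ k ^ (-θ) ≤ K`, by Cauchy condensation.
* `norm_sub_le_of_small` bounds the increments of `y` over intervals on which `ω` varies little, by
  induction on the number of steps. On the other intervals the increments are controlled because
  `‖y‖ = 1` (`norm_sub_le_of_norm_le_one`); hence no subdivision into such intervals is needed.
* `exists_partition_defect_le` shows that the Euler errors have a small sum on suitable partitions,
  because `ω` has small `r`-variation over short intervals for each `r > p`.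
* `log_norm_sub_le` is the resulting growth estimate as long as `z` does not vanish, and
  `norm_le_of_growth_bound_of_ne_zero` removes this restriction.
-/

namespace Young

/-! ### Controls -/

/-- `f` is a `p`-control on `S`: it is nonnegative and `f ^ p` is superadditive on ordered triples
of points of `S`. The model is the `p`-variation `f u v` of a path between `u` and `v`. -/
structure IsPControl {α : Type*} [Preorder α] (p : ℝ) (S : Set α) (f : α → α → ℝ) : Prop where
  nonneg : ∀ ⦃u v⦄, u ∈ S → v ∈ S → u ≤ v → 0 ≤ f u v
  superadd : ∀ ⦃u v s⦄, u ∈ S → v ∈ S → s ∈ S → u ≤ v → v ≤ s →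
    f u v ^ p + f v s ^ p ≤ f u s ^ p

namespace IsPControl

variable {α β : Type*} [Preorder α] [Preorder β] {p q : ℝ} {S : Set α} {f g : α → α → ℝ}

lemma subset {S' : Set α} (hf : IsPControl p S f) (h : S' ⊆ S) : IsPControl p S' f :=
  ⟨fun _ _ hu hv => hf.nonneg (h hu) (h hv),
    fun _ _ _ hu hv hs => hf.superadd (h hu) (h hv) (h hs)⟩

lemma comp {R : Set β} (hf : IsPControl p S f) (t : β → α) (ht : ∀ i ∈ R, t i ∈ S)
    (hmono : MonotoneOn t R) : IsPControl p R (fun i j => f (t i) (t j)) :=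
  ⟨fun _ _ hu hv h => hf.nonneg (ht _ hu) (ht _ hv) (hmono hu hv h),
    fun _ _ _ hu hv hs h h' => hf.superadd (ht _ hu) (ht _ hv) (ht _ hs) (hmono hu hv h)
      (hmono hv hs h')⟩

lemma mono_right (hf : IsPControl p S f) (hp : 0 < p) {u v s : α} (hu : u ∈ S) (hv : v ∈ S)
    (hs : s ∈ S) (huv : u ≤ v) (hvs : v ≤ s) : f u v ≤ f u s := by
  have h1 := hf.superadd hu hv hs huv hvs
  have h2 := Real.rpow_nonneg (hf.nonneg hv hs hvs) p
  exact (Real.rpow_le_rpow_iff (hf.nonneg hu hv huv) (hf.nonneg hu hs (huv.trans hvs)) hp).1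
    (by linarith)

lemma mono_left (hf : IsPControl p S f) (hp : 0 < p) {u v s : α} (hu : u ∈ S) (hv : v ∈ S)
    (hs : s ∈ S) (huv : u ≤ v) (hvs : v ≤ s) : f v s ≤ f u s := by
  have h1 := hf.superadd hu hv hs huv hvs
  have h2 := Real.rpow_nonneg (hf.nonneg hu hv huv) p
  exact (Real.rpow_le_rpow_iff (hf.nonneg hv hs hvs) (hf.nonneg hu hs (huv.trans hvs)) hp).1
    (by linarith)

lemma mono (hf : IsPControl p S f) (hp : 0 < p) {u v s t : α} (hu : u ∈ S) (hv : v ∈ S)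
    (hs : s ∈ S) (ht : t ∈ S) (huv : u ≤ v) (hvs : v ≤ s) (hst : s ≤ t) : f v s ≤ f u t :=
  (hf.mono_left hp hu hv hs huv hvs).trans (hf.mono_right hp hu hs ht (huv.trans hvs) hst)

lemma mono_exponent (hf : IsPControl p S f) (hp : 0 < p) (hpq : p ≤ q) : IsPControl q S f := by
  refine ⟨hf.nonneg, fun u v s hu hv hs huv hvs => ?_⟩
  have h1 := hf.nonneg hu hv huv
  have h2 := hf.nonneg hv hs hvs
  have h3 := hf.nonneg hu hs (huv.trans hvs)
  have key : ∀ x : ℝ, 0 ≤ x → x ^ q = (x ^ p) ^ (q / p) := fun x hx => by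
    rw [← Real.rpow_mul hx, mul_div_cancel₀ _ hp.ne']
  rw [key _ h1, key _ h2, key _ h3]
  have hr : 1 ≤ q / p := (one_le_div hp).2 hpq
  lift f u v ^ p to NNReal using Real.rpow_nonneg h1 p with a ha
  lift f v s ^ p to NNReal using Real.rpow_nonneg h2 p with b hb
  have := NNReal.add_rpow_le_rpow_add a b hr
  refine le_trans (by exact_mod_cast this)
    (Real.rpow_le_rpow (a.2.trans (by simp)) ?_ (by linarith))
  rw [NNReal.coe_add, ha, hb]
  exact hf.superadd hu hv hs huv hvs

lemma rpow (hf : IsPControl p S f) {r : ℝ} (hr : 0 < r) :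
    IsPControl (p / r) S (fun u v => f u v ^ r) := by
  refine ⟨fun u v hu hv h => Real.rpow_nonneg (hf.nonneg hu hv h) r,
    fun u v s hu hv hs huv hvs => ?_⟩
  have h1 := hf.nonneg hu hv huv
  have h2 := hf.nonneg hv hs hvs
  have h3 := hf.nonneg hu hs (huv.trans hvs)
  rw [← Real.rpow_mul h1, ← Real.rpow_mul h2, ← Real.rpow_mul h3, mul_div_cancel₀ _ hr.ne']
  exact hf.superadd hu hv hs huv hvs

lemma const_mul (hf : IsPControl p S f) {c : ℝ} (hc : 0 ≤ c) :
    IsPControl p S (fun u v => c * f u v) := by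
  refine ⟨fun u v hu hv h => mul_nonneg hc (hf.nonneg hu hv h), fun u v s hu hv hs huv hvs => ?_⟩
  rw [Real.mul_rpow hc (hf.nonneg hu hv huv), Real.mul_rpow hc (hf.nonneg hv hs hvs),
    Real.mul_rpow hc (hf.nonneg hu hs (huv.trans hvs)), ← mul_add]
  exact mul_le_mul_of_nonneg_left (hf.superadd hu hv hs huv hvs) (Real.rpow_nonneg hc p)

/-- Sums of `p`-controls are `p`-controls, by Minkowski's inequality. -/
lemma add (hp : 1 ≤ p) (hf : IsPControl p S f) (hg : IsPControl p S g) :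
    IsPControl p S (fun u v => f u v + g u v) := by
  have hp0 : 0 < p := by linarith
  refine ⟨fun u v hu hv h => add_nonneg (hf.nonneg hu hv h) (hg.nonneg hu hv h),
    fun u v s hu hv hs huv hvs => ?_⟩
  have f1 := hf.nonneg hu hv huv
  have f2 := hf.nonneg hv hs hvs
  have f3 := hf.nonneg hu hs (huv.trans hvs)
  have g1 := hg.nonneg hu hv huv
  have g2 := hg.nonneg hv hs hvs
  have g3 := hg.nonneg hu hs (huv.trans hvs)
  have hM := Real.Lp_add_le_of_nonneg (s := Finset.univ) (f := ![f u v, f v s])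
    (g := ![g u v, g v s]) hp
    (by intro i _; fin_cases i <;> simpa) (by intro i _; fin_cases i <;> simpa)
  simp only [Fin.sum_univ_two, Matrix.cons_val_zero, Matrix.cons_val_one] at hM
  have hroot : ∀ {a b c : ℝ}, 0 ≤ a → 0 ≤ b → 0 ≤ c → a ^ p + b ^ p ≤ c ^ p →
      (a ^ p + b ^ p) ^ (1 / p) ≤ c := fun {a b c} ha hb hc h => by
    have h' := Real.rpow_le_rpow (by positivity) h (by positivity : 0 ≤ 1 / p)
    rwa [← Real.rpow_mul hc, mul_one_div_cancel hp0.ne', Real.rpow_one] at h'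
  have h := hM.trans (add_le_add (hroot f1 f2 f3 (hf.superadd hu hv hs huv hvs))
    (hroot g1 g2 g3 (hg.superadd hu hv hs huv hvs)))
  have h' := Real.rpow_le_rpow (by positivity) h hp0.le
  rwa [← Real.rpow_mul (by positivity), one_div_mul_cancel hp0.ne', Real.rpow_one] at h'

lemma sum_rpow_le (hf : IsPControl p S f) {n : ℕ} (s : ℕ → α) (hs : ∀ i ≤ n, s i ∈ S)
    (hmono : ∀ i < n, s i ≤ s (i + 1)) :
    ∑ i ∈ Finset.range n, f (s i) (s (i + 1)) ^ p ≤ f (s 0) (s n) ^ p := by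
  suffices h : ∀ m ≤ n, s 0 ≤ s m ∧
      ∑ i ∈ Finset.range m, f (s i) (s (i + 1)) ^ p ≤ f (s 0) (s m) ^ p from (h n le_rfl).2
  intro m
  induction m with
  | zero =>
    intro _
    exact ⟨le_rfl, by
      simpa using Real.rpow_nonneg (hf.nonneg (hs 0 (by lia)) (hs 0 (by lia)) le_rfl) p⟩
  | succ m ih =>
    intro hm
    obtain ⟨h1, h2⟩ := ih (by lia)
    refine ⟨h1.trans (hmono m (by lia)), ?_⟩
    rw [Finset.sum_range_succ]
    exact (add_le_add_left h2 _).trans (hf.superadd (hs 0 (by lia)) (hs m (by lia))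
      (hs (m + 1) hm) h1 (hmono m (by lia)))

end IsPControl

/-! ### The discrete Young–Loève estimate -/

lemma sum_rpow_neg_le_constK {p q : ℝ} (hθ : 1 < 1 / p + 1 / q) (n : ℕ) :
    ∑ k ∈ Finset.range n, (k : ℝ) ^ (-(1 / p + 1 / q)) ≤ constK p q := by
  unfold constK
  set θ := 1 / p + 1 / q
  have h2 : (2 : ℝ) ^ (1 - θ) < 1 := Real.rpow_lt_one_of_one_lt_of_neg (by norm_num) (by linarith)
  calc ∑ k ∈ Finset.range n, (k : ℝ) ^ (-θ) ≤ ∑ k ∈ Finset.range (2 ^ n), (k : ℝ) ^ (-θ) :=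
        Finset.sum_le_sum_of_subset_of_nonneg
          (Finset.range_subset_range.2 Nat.lt_two_pow_self.le) fun _ _ _ => by positivity
    _ ≤ ((0 : ℕ) : ℝ) ^ (-θ) + ∑ k ∈ Finset.range n, 2 ^ k • ((2 ^ k : ℕ) : ℝ) ^ (-θ) := by
        refine Finset.le_sum_condensed (f := fun k : ℕ => (k : ℝ) ^ (-θ)) ?_ n
        intro m k hm hmk
        exact Real.rpow_le_rpow_of_nonpos (by exact_mod_cast hm) (by exact_mod_cast hmk)
          (by linarith)
    _ = ∑ k ∈ Finset.range n, ((2 : ℝ) ^ (1 - θ)) ^ k := by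
        rw [Nat.cast_zero, Real.zero_rpow (by linarith), zero_add]
        refine Finset.sum_congr rfl fun k _ => ?_
        rw [nsmul_eq_mul, ← Real.rpow_natCast ((2 : ℝ) ^ (1 - θ)), ← Real.rpow_mul (by norm_num)]
        push_cast
        rw [← Real.rpow_natCast, ← Real.rpow_mul (by norm_num), ← Real.rpow_add (by norm_num)]
        congr 1; ring
    _ ≤ (1 - (2 : ℝ) ^ (1 - θ))⁻¹ := by
        rw [← tsum_geometric_of_lt_one (by positivity) h2]
        exact (summable_geometric_of_lt_one (by positivity) h2).sum_le_tsum _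
          fun _ _ => by positivity

lemma constK_ge_one {p q : ℝ} (hθ : 1 < 1 / p + 1 / q) : 1 ≤ constK p q := by
  refine le_trans (le_of_eq ?_) (sum_rpow_neg_le_constK hθ 2)
  rw [Finset.sum_range_succ, Finset.sum_range_one, Nat.cast_zero,
    Real.zero_rpow (by linarith)]
  simp

/-- By Hölder's inequality with the conjugate exponents `q θ` and `p θ`, `θ = 1 / p + 1 / q`, the
smallest of `n` products `a k * b k` is at most `n ^ (-θ)` times the product of the norms. -/
lemma exists_mul_le_rpow_neg {p q : ℝ} (hp : 0 < p) (hq : 0 < q) {n : ℕ} (hn : 0 < n)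
    {a b : ℕ → ℝ} {F G : ℝ} (ha : ∀ k < n, 0 ≤ a k) (hb : ∀ k < n, 0 ≤ b k) (hF : 0 ≤ F)
    (hG : 0 ≤ G) (haF : ∑ k ∈ Finset.range n, a k ^ q ≤ F ^ q)
    (hbG : ∑ k ∈ Finset.range n, b k ^ p ≤ G ^ p) :
    ∃ k < n, a k * b k ≤ (n : ℝ) ^ (-(1 / p + 1 / q)) * (F * G) := by
  set θ := 1 / p + 1 / q with hθ
  have hθ0 : 0 < θ := by positivity
  have hn' : (0 : ℝ) < n := by exact_mod_cast hn
  have hconj : (q * θ).HolderConjugate (p * θ) := by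
    refine Real.holderConjugate_iff.2 ⟨?_, ?_⟩
    · have : q * θ = 1 + q / p := by rw [hθ]; field_simp; ring
      have : 0 < q / p := by positivity
      linarith
    · have : (q * θ)⁻¹ + (p * θ)⁻¹ = (1 / p + 1 / q) / θ := by field_simp; ring
      rw [this, ← hθ, div_self hθ0.ne']
  have hpow : ∀ {x r : ℝ}, 0 ≤ x → (x ^ (1 / θ)) ^ (r * θ) = x ^ r := fun {x r} hx => by
    rw [← Real.rpow_mul hx]; congr 1; field_simp
  have hpow' : ∀ {x r : ℝ}, 0 < r → 0 ≤ x → (x ^ r) ^ (1 / (r * θ)) = x ^ (1 / θ) :=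
    fun {x r} hr hx => by
      rw [← Real.rpow_mul hx]; congr 1; field_simp
  have hH := Real.inner_le_Lp_mul_Lq_of_nonneg (s := Finset.range n)
    (f := fun k => a k ^ (1 / θ)) (g := fun k => b k ^ (1 / θ)) hconj
    (fun k hk => Real.rpow_nonneg (ha k (Finset.mem_range.1 hk)) _)
    (fun k hk => Real.rpow_nonneg (hb k (Finset.mem_range.1 hk)) _)
  rw [Finset.sum_congr rfl fun k hk => hpow (r := q) (ha k (Finset.mem_range.1 hk)),
    Finset.sum_congr rfl fun k hk => hpow (r := p) (hb k (Finset.mem_range.1 hk))] at hH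
  have h1 : (∑ k ∈ Finset.range n, a k ^ q) ^ (1 / (q * θ)) ≤ F ^ (1 / θ) := by
    rw [← hpow' hq hF]
    exact Real.rpow_le_rpow (Finset.sum_nonneg fun k hk =>
      Real.rpow_nonneg (ha k (Finset.mem_range.1 hk)) _) haF (by positivity)
  have h2 : (∑ k ∈ Finset.range n, b k ^ p) ^ (1 / (p * θ)) ≤ G ^ (1 / θ) := by
    rw [← hpow' hp hG]
    exact Real.rpow_le_rpow (Finset.sum_nonneg fun k hk =>
      Real.rpow_nonneg (hb k (Finset.mem_range.1 hk)) _) hbG (by positivity)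
  have h3 : ∑ k ∈ Finset.range n, a k ^ (1 / θ) * b k ^ (1 / θ) ≤
      ∑ _k ∈ Finset.range n, F ^ (1 / θ) * G ^ (1 / θ) / n := by
    rw [Finset.sum_const, Finset.card_range, nsmul_eq_mul, mul_div_cancel₀ _ hn'.ne']
    exact hH.trans (mul_le_mul h1 h2 (Real.rpow_nonneg (Finset.sum_nonneg fun k hk =>
      Real.rpow_nonneg (hb k (Finset.mem_range.1 hk)) _) _) (by positivity))
  obtain ⟨k, hk, hle⟩ := Finset.exists_le_of_sum_le ⟨0, Finset.mem_range.2 hn⟩ h3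
  have hk := Finset.mem_range.1 hk
  refine ⟨k, hk, ?_⟩
  rw [← Real.mul_rpow (ha k hk) (hb k hk), ← Real.mul_rpow hF hG] at hle
  have hroot : ∀ {x : ℝ}, 0 ≤ x → (x ^ (1 / θ)) ^ θ = x := fun {x} hx => by
    rw [← Real.rpow_mul hx, one_div_mul_cancel hθ0.ne', Real.rpow_one]
  have := Real.rpow_le_rpow (Real.rpow_nonneg (mul_nonneg (ha k hk) (hb k hk)) _) hle hθ0.le
  rw [hroot (mul_nonneg (ha k hk) (hb k hk)), Real.div_rpow (by positivity) hn'.le,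
    hroot (mul_nonneg hF hG)] at this
  rwa [Real.rpow_neg hn'.le, inv_mul_eq_div]

/-- The discrete Young–Loève estimate. Interior points are removed one at a time, each time the
one with the smallest defect; the `k`-th last removal costs at most `k ^ (-θ)` times the product
of the controls, where `θ = 1 / p + 1 / q`, and `∑ k ^ (-θ) ≤ K`. -/
theorem norm_sum_sub_le_of_defect_le {α E : Type*} [Preorder α] [NormedAddCommGroup E] {p q c : ℝ}
    {S : Set α} {f g : α → α → ℝ} (hp : 0 < p) (hq : 0 < q) (hθ : 1 < 1 / p + 1 / q)
    (hf : IsPControl q S f) (hg : IsPControl p S g) (hc : 0 ≤ c) (Ξ : α → α → E)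
    (hΞ : ∀ u ∈ S, ∀ v ∈ S, ∀ s ∈ S, u ≤ v → v ≤ s →
      ‖Ξ u v + Ξ v s - Ξ u s‖ ≤ c * (f u v * g v s))
    {n : ℕ} (hn : 0 < n) (s : ℕ → α) (hs : ∀ i ≤ n, s i ∈ S) (hmono : ∀ i < n, s i ≤ s (i + 1)) :
    ‖∑ i ∈ Finset.range n, Ξ (s i) (s (i + 1)) - Ξ (s 0) (s n)‖ ≤
      c * constK p q * (f (s 0) (s n) * g (s 0) (s n)) := by
  have hle : ∀ (n : ℕ) (s : ℕ → α), (∀ i < n, s i ≤ s (i + 1)) → ∀ j ≤ n, ∀ i ≤ j, s i ≤ s j := by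
    intro n s hmono j hj i hij
    induction j, hij using Nat.le_induction with
    | base => exact le_rfl
    | succ j hij ih => exact (ih (by lia)).trans (hmono j (by lia))
  have hpos : ∀ (n : ℕ) (s : ℕ → α), (∀ i ≤ n, s i ∈ S) → (∀ i < n, s i ≤ s (i + 1)) →
      0 ≤ f (s 0) (s n) * g (s 0) (s n) := fun n s hs hmono =>
    have h := hle n s hmono n le_rfl 0 (Nat.zero_le _)
    mul_nonneg (hf.nonneg (hs 0 (by lia)) (hs n le_rfl) h)
      (hg.nonneg (hs 0 (by lia)) (hs n le_rfl) h)
  have main : ∀ (m : ℕ) (s : ℕ → α), (∀ i ≤ m + 1, s i ∈ S) → (∀ i < m + 1, s i ≤ s (i + 1)) →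
      ‖∑ i ∈ Finset.range (m + 1), Ξ (s i) (s (i + 1)) - Ξ (s 0) (s (m + 1))‖ ≤
        c * (∑ k ∈ Finset.range (m + 1), (k : ℝ) ^ (-(1 / p + 1 / q))) *
          (f (s 0) (s (m + 1)) * g (s 0) (s (m + 1))) := by
    intro m
    induction m with
    | zero =>
      intro s hs hmono
      have h0 : (0 : ℝ) ^ (-(1 / p + 1 / q)) = 0 := Real.zero_rpow (by linarith)
      simp only [zero_add, Finset.range_one, Finset.sum_singleton, Nat.cast_zero, h0, sub_self,
        norm_zero, mul_zero, zero_mul, le_refl]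
    | succ m ih =>
      intro s hs hmono
      have hle' := hle _ s hmono
      have hF := hf.nonneg (hs 0 (by lia)) (hs (m + 1 + 1) le_rfl) (hle' _ le_rfl 0 (by lia))
      have hG := hg.nonneg (hs 0 (by lia)) (hs (m + 1 + 1) le_rfl) (hle' _ le_rfl 0 (by lia))
      obtain ⟨k, hk, hkle⟩ := exists_mul_le_rpow_neg hp hq (n := m + 1) (by lia)
        (a := fun k => f (s k) (s (k + 1))) (b := fun k => g (s (k + 1)) (s (k + 1 + 1)))
        (fun k hk => hf.nonneg (hs _ (by lia)) (hs _ (by lia)) (hmono k (by lia)))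
        (fun k hk => hg.nonneg (hs _ (by lia)) (hs _ (by lia)) (hmono (k + 1) (by lia))) hF hG
        ((hf.sum_rpow_le s (fun i hi => hs i (by lia)) (fun i hi => hmono i (by lia))).trans
          (Real.rpow_le_rpow
            (hf.nonneg (hs _ (by lia)) (hs _ (by lia)) (hle' _ (by lia) _ (by lia)))
            (hf.mono_right hq (hs _ (by lia)) (hs _ (by lia)) (hs _ (by lia))
              (hle' _ (by lia) _ (by lia)) (hle' _ (by lia) _ (by lia))) hq.le))
        ((hg.sum_rpow_le (fun k => s (k + 1)) (fun i hi => hs _ (by lia))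
          (fun i hi => hmono _ (by lia))).trans
          (Real.rpow_le_rpow
            (hg.nonneg (hs _ (by lia)) (hs _ (by lia)) (hle' _ (by lia) _ (by lia)))
            (hg.mono_left hp (hs _ (by lia)) (hs _ (by lia)) (hs _ (by lia))
              (hle' _ (by lia) _ (by lia)) (hle' _ (by lia) _ (by lia))) hp.le))
      obtain ⟨l, rfl⟩ : ∃ l, m = k + l := ⟨m - k, by lia⟩
      -- the sequence with the point `s (k + 1)` removed
      set s' : ℕ → α := fun j => if j ≤ k then s j else s (j + 1) with hs'
      have hlow : ∀ j ≤ k, s' j = s j := fun j hj => by simp [hs', hj]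
      have hhigh : ∀ j, k < j → s' j = s (j + 1) := fun j hj => by simp [hs', hj]
      have hsum : ∑ i ∈ Finset.range (k + l + 1 + 1), Ξ (s i) (s (i + 1)) =
          ∑ i ∈ Finset.range (k + l + 1), Ξ (s' i) (s' (i + 1)) +
            (Ξ (s k) (s (k + 1)) + Ξ (s (k + 1)) (s (k + 1 + 1)) - Ξ (s k) (s (k + 1 + 1))) := by
        rw [show k + l + 1 + 1 = (k + 1 + 1) + l by lia, show k + l + 1 = (k + 1) + l by lia,
          Finset.sum_range_add _ (k + 1 + 1) l, Finset.sum_range_add _ (k + 1) l,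
          Finset.sum_range_succ, Finset.sum_range_succ, Finset.sum_range_succ]
        have e1 : ∑ i ∈ Finset.range k, Ξ (s' i) (s' (i + 1)) =
            ∑ i ∈ Finset.range k, Ξ (s i) (s (i + 1)) :=
          Finset.sum_congr rfl fun i hi => by
            have := Finset.mem_range.1 hi
            rw [hlow i (by lia), hlow (i + 1) (by lia)]
        have e2 : ∑ i ∈ Finset.range l, Ξ (s' (k + 1 + i)) (s' (k + 1 + i + 1)) =
            ∑ i ∈ Finset.range l, Ξ (s (k + 1 + 1 + i)) (s (k + 1 + 1 + i + 1)) :=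
          Finset.sum_congr rfl fun i _ => by
            rw [hhigh (k + 1 + i) (by lia), hhigh (k + 1 + i + 1) (by lia)]
            congr 2 <;> lia
        rw [e1, e2, hlow k le_rfl, hhigh (k + 1) (by lia)]
        abel
      have hIH := ih s'
        (fun i hi => by
          rcases le_or_gt i k with h | h
          · rw [hlow i h]; exact hs _ (by lia)
          · rw [hhigh i h]; exact hs _ (by lia))
        (fun i hi => by
          rcases le_or_gt i k with h | h
          · rw [hlow i h]
            rcases le_or_gt (i + 1) k with h' | h'
            · rw [hlow _ h']; exact hmono _ (by lia)
            · rw [hhigh _ h']; exact hle' _ (by lia) _ (by lia)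
          · rw [hhigh i h, hhigh (i + 1) (by lia)]; exact hmono _ (by lia))
      rw [hlow 0 (by lia), hhigh (k + l + 1) (by lia)] at hIH
      have hdef := hΞ (s k) (hs _ (by lia)) (s (k + 1)) (hs _ (by lia)) (s (k + 1 + 1))
        (hs _ (by lia)) (hmono _ (by lia)) (hmono _ (by lia))
      have hdef' := hdef.trans (mul_le_mul_of_nonneg_left hkle hc)
      rw [hsum, add_sub_right_comm, Finset.sum_range_succ _ (k + l + 1)]
      refine (norm_add_le _ _).trans ((add_le_add hIH hdef').trans (le_of_eq ?_))
      ring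
  obtain ⟨m, rfl⟩ : ∃ m, n = m + 1 := ⟨n - 1, by lia⟩
  exact (main m s hs hmono).trans (mul_le_mul_of_nonneg_right
    (mul_le_mul_of_nonneg_left (sum_rpow_neg_le_constK hθ _) hc) (hpos _ s hs hmono))

/-! ### A priori bounds for discrete rough equations -/

lemma IsPControl.of_monotoneOn {α : Type*} [Preorder α] {S : Set α} {σ : α → ℝ}
    (hσ : MonotoneOn σ S) : IsPControl 1 S (fun u v => σ v - σ u) :=
  ⟨fun _ _ hu hv h => sub_nonneg.2 (hσ hu hv h), fun u v s _ _ _ _ _ => by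
    simp only [Real.rpow_one]; linarith⟩

section Discrete

variable {V : Type*} [NormedAddCommGroup V] [NormedSpace ℝ V] {p q β L : ℝ} {n : ℕ}
  {ω : ℕ → ℝ} {W D : ℕ → ℕ → ℝ} {y g : ℕ → V}

/-- On a stretch where `W` is small, a discrete path with increments `Δω • g`, up to a remainder
controlled by `D`, satisfies the bound `2 * (D + β * W)`. The proof is by induction on the length
of the stretch: the defects in the Young–Loève estimate over `[i, j]` only involve
increments of `y` over strictly shorter stretches. -/
theorem norm_sub_le_of_small (hp : 1 ≤ p) (hpq : p ≤ q) (hθ : 1 < 1 / p + 1 / q)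
    (hD : IsPControl 1 (Set.Icc 0 n) D) (hW : IsPControl p (Set.Icc 0 n) W)
    (hω : ∀ i j, i ≤ j → j ≤ n → |ω j - ω i| ≤ W i j) (hβ : ∀ i ≤ n, ‖g i‖ ≤ β) (hL : 0 ≤ L)
    (hg : ∀ i j, i ≤ j → j ≤ n → ‖g j - g i‖ ≤ L * ‖y j - y i‖)
    (hy : ∀ i < n, ‖y (i + 1) - y i - (ω (i + 1) - ω i) • g i‖ ≤ D i (i + 1))
    {i j : ℕ} (hij : i ≤ j) (hj : j ≤ n) (hsmall : L * constK p q * W i j ≤ 1 / 2) :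
    ‖y j - y i‖ ≤ 2 * (D i j + β * W i j) := by
  have hp0 : 0 < p := by linarith
  have hq0 : 0 < q := by linarith
  have hβ0 : 0 ≤ β := (norm_nonneg _).trans (hβ 0 (Nat.zero_le _))
  have hK : 0 ≤ constK p q := zero_le_one.trans (constK_ge_one hθ)
  have hφ : IsPControl q (Set.Icc 0 n) (fun i j => 2 * (D i j + β * W i j)) :=
    ((hD.mono_exponent one_pos (hp.trans hpq)).add (hp.trans hpq)
      ((hW.mono_exponent hp0 hpq).const_mul hβ0)).const_mul (by norm_num)
  have hmem : ∀ {k : ℕ}, k ≤ n → k ∈ Set.Icc 0 n := fun h => ⟨Nat.zero_le _, h⟩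
  obtain ⟨m, hm⟩ : ∃ m, m = j - i := ⟨_, rfl⟩
  induction m using Nat.strong_induction_on generalizing i j with
  | _ m ih =>
  rcases hij.eq_or_lt with rfl | hlt
  · simpa using hφ.nonneg (hmem hj) (hmem hj) le_rfl
  have hsub : Set.Icc i j ⊆ Set.Icc 0 n := fun k hk => hmem (hk.2.trans hj)
  have hsew := norm_sum_sub_le_of_defect_le (S := Set.Icc i j) hp0 hq0 hθ (hφ.subset hsub)
    (hW.subset hsub) hL (fun u v => (ω v - ω u) • g u)
    (fun u hu v hv s hs huv hvs => by
      have hid : (ω v - ω u) • g u + (ω s - ω v) • g v - (ω s - ω u) • g u =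
          (ω s - ω v) • (g v - g u) := by module
      rw [hid, norm_smul, Real.norm_eq_abs]
      -- if `v = s` the defect vanishes; otherwise `[u, v]` is shorter than `[i, j]`
      rcases hvs.eq_or_lt with rfl | hvs'
      · rw [sub_self, abs_zero, zero_mul]
        exact mul_nonneg hL (mul_nonneg (hφ.nonneg (hsub hu) (hsub hv) huv)
          (hW.nonneg (hsub hv) (hsub hv) le_rfl))
      · have hyuv := ih (v - u) (by have := hu.1; have := hs.2; lia) huv (hv.2.trans hj)
          ((mul_le_mul_of_nonneg_left (hW.mono hp0 (hsub ⟨le_rfl, hlt.le⟩) (hsub hu) (hsub hv)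
            (hmem hj) hu.1 huv hv.2) (mul_nonneg hL hK)).trans hsmall) rfl
        calc |ω s - ω v| * ‖g v - g u‖
            ≤ W v s * (L * (2 * (D u v + β * W u v))) :=
              mul_le_mul (hω v s hvs (hs.2.trans hj))
                ((hg u v huv (hv.2.trans hj)).trans (mul_le_mul_of_nonneg_left hyuv hL))
                (norm_nonneg _) (hW.nonneg (hsub hv) (hsub hs) hvs)
          _ = _ := by ring)
    (n := j - i) (by lia) (fun l => i + l)
    (fun l hl => ⟨by lia, by lia⟩) (fun l _ => by lia)
  have hDsum := (hD.subset hsub).sum_rpow_le (n := j - i) (fun l => i + l)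
    (fun l hl => ⟨by lia, by lia⟩) (fun l _ => by lia)
  simp only [Real.rpow_one, add_zero, ← add_assoc, Nat.add_sub_cancel' hij] at hDsum hsew
  have htel : y j - y i = ∑ l ∈ Finset.range (j - i),
      (y (i + l + 1) - y (i + l) - (ω (i + l + 1) - ω (i + l)) • g (i + l)) +
      (∑ l ∈ Finset.range (j - i), (ω (i + l + 1) - ω (i + l)) • g (i + l)
        - (ω j - ω i) • g i) + (ω j - ω i) • g i := by
    rw [Finset.sum_sub_distrib]
    have := Finset.sum_range_sub (fun l => y (i + l)) (j - i)
    simp only [add_zero, ← add_assoc, Nat.add_sub_cancel' hij] at this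
    rw [this]; abel
  have h1 : ‖∑ l ∈ Finset.range (j - i),
      (y (i + l + 1) - y (i + l) - (ω (i + l + 1) - ω (i + l)) • g (i + l))‖ ≤ D i j :=
    (norm_sum_le_of_le _ fun l hl => hy (i + l) (by have := Finset.mem_range.1 hl; lia)).trans
      hDsum
  have h2 : ‖(ω j - ω i) • g i‖ ≤ W i j * β := by
    rw [norm_smul]
    exact mul_le_mul (hω i j hij hj) (hβ i (hij.trans hj)) (norm_nonneg _)
      (hW.nonneg (hmem (hij.trans hj)) (hmem hj) hij)
  have h3 := mul_le_mul_of_nonneg_right hsmall (hφ.nonneg (hmem (hij.trans hj)) (hmem hj) hij)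
  rw [htel]
  refine (norm_add₃_le).trans ((add_le_add (add_le_add h1 hsew) h2).trans ?_)
  linarith

/-- For a path of unit length no smallness is needed: where `W` is large, `‖y j - y i‖ ≤ 2` is
already controlled by `W ^ p`. -/
theorem norm_sub_le_of_norm_le_one (hp : 1 ≤ p) (hpq : p ≤ q) (hθ : 1 < 1 / p + 1 / q)
    (hD : IsPControl 1 (Set.Icc 0 n) D) (hW : IsPControl p (Set.Icc 0 n) W)
    (hω : ∀ i j, i ≤ j → j ≤ n → |ω j - ω i| ≤ W i j) (hβ : ∀ i ≤ n, ‖g i‖ ≤ β) (hL : 0 ≤ L)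
    (hg : ∀ i j, i ≤ j → j ≤ n → ‖g j - g i‖ ≤ L * ‖y j - y i‖)
    (hy : ∀ i < n, ‖y (i + 1) - y i - (ω (i + 1) - ω i) • g i‖ ≤ D i (i + 1))
    (hy1 : ∀ i ≤ n, ‖y i‖ ≤ 1) {i j : ℕ} (hij : i ≤ j) (hj : j ≤ n) :
    ‖y j - y i‖ ≤ 2 * (D i j + β * W i j) + 2 * (2 * L * constK p q * W i j) ^ p := by
  have hmem : ∀ {k : ℕ}, k ≤ n → k ∈ Set.Icc 0 n := fun h => ⟨Nat.zero_le _, h⟩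
  have hK : 0 ≤ constK p q := zero_le_one.trans (constK_ge_one hθ)
  have hβ0 : 0 ≤ β := (norm_nonneg _).trans (hβ 0 (Nat.zero_le _))
  have hW0 := hW.nonneg (hmem (hij.trans hj)) (hmem hj) hij
  have hD0 := hD.nonneg (hmem (hij.trans hj)) (hmem hj) hij
  rcases le_or_gt (L * constK p q * W i j) (1 / 2) with h | h
  · have := norm_sub_le_of_small hp hpq hθ hD hW hω hβ hL hg hy hij hj h
    have : 0 ≤ (2 * L * constK p q * W i j) ^ p := by positivity
    linarith
  · have h1 : 1 ≤ (2 * L * constK p q * W i j) ^ p :=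
      Real.one_le_rpow (by linarith) (by linarith)
    have h2 : ‖y j - y i‖ ≤ 2 :=
      (norm_sub_le _ _).trans (by linarith [hy1 i (hij.trans hj), hy1 j hj])
    have : 0 ≤ D i j + β * W i j := by positivity
    linarith

end Discrete

/-! ### The polar decomposition of one step -/

section Sphere

variable {E : Type*} [NormedAddCommGroup E] [InnerProductSpace ℝ E]

lemma norm_add_sq_of_norm_eq_one {y h : E} (hy : ‖y‖ = 1) :
    ‖y + h‖ ^ 2 = 1 + 2 * inner ℝ y h + ‖h‖ ^ 2 := by
  rw [norm_add_sq_real, hy, one_pow]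

lemma log_norm_add_le {y h : E} (hy : ‖y‖ = 1) (hyh : y + h ≠ 0) :
    Real.log ‖y + h‖ ≤ inner ℝ y h + ‖h‖ ^ 2 / 2 := by
  have h1 := Real.log_le_sub_one_of_pos (pow_pos (norm_pos_iff.2 hyh) 2)
  rw [Real.log_pow, norm_add_sq_of_norm_eq_one hy] at h1
  push_cast at h1
  linarith

/-- Radial projection to the sphere agrees with orthogonal projection to the tangent space up to
a quadratic error. -/
lemma norm_normalize_add_sub_le {y h : E} (hy : ‖y‖ = 1) (hyh : y + h ≠ 0) :
    ‖‖y + h‖⁻¹ • (y + h) - y - (h - inner ℝ y h • y)‖ ≤ 5 / 2 * ‖h‖ ^ 2 := by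
  set N := ‖y + h‖ with hN
  set s : ℝ := inner ℝ y h with hs
  have hN0 : 0 < N := norm_pos_iff.2 hyh
  have hs1 : |s| ≤ ‖h‖ := by
    have := abs_real_inner_le_norm y h
    rwa [hy, one_mul] at this
  have hN1 : |N - 1| ≤ ‖h‖ := by
    have := abs_norm_sub_norm_le (y + h) y
    rwa [hy, add_sub_cancel_left] at this
  have hNlow : 1 + s ≤ N := by
    have := real_inner_le_norm y (y + h)
    rwa [inner_add_right, real_inner_self_eq_norm_sq, hy, one_pow, one_mul] at this
  have hNup : N ≤ 1 + s + ‖h‖ ^ 2 / 2 := by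
    have := norm_add_sq_of_norm_eq_one (h := h) hy
    nlinarith [sq_nonneg (N - 1)]
  have hid : N⁻¹ • (y + h) - y - (h - s • y) = (N⁻¹ * (1 - N + s * N)) • (y + h) - s • h := by
    have : N⁻¹ * (1 - N + s * N) = N⁻¹ - 1 + s := by field_simp
    rw [this]; module
  rw [hid]
  have hsN : |s * (N - 1)| ≤ ‖h‖ * ‖h‖ := by
    rw [abs_mul]; exact mul_le_mul hs1 hN1 (abs_nonneg _) (norm_nonneg _)
  have h1 : ‖(N⁻¹ * (1 - N + s * N)) • (y + h)‖ ≤ ‖h‖ ^ 2 / 2 + ‖h‖ ^ 2 := by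
    rw [norm_smul, ← hN, norm_mul, norm_inv, Real.norm_of_nonneg hN0.le, mul_comm, ← mul_assoc,
      mul_inv_cancel₀ hN0.ne', one_mul, Real.norm_eq_abs, abs_le]
    have := abs_le.1 hsN
    constructor <;> nlinarith
  have h2 : ‖s • h‖ ≤ ‖h‖ ^ 2 := by
    rw [norm_smul, Real.norm_eq_abs, sq]
    exact mul_le_mul_of_nonneg_right hs1 (norm_nonneg _)
  exact (norm_sub_le _ _).trans (by linarith)

lemma norm_sub_inner_smul_le {y x : E} (hy : ‖y‖ = 1) : ‖x - inner ℝ y x • y‖ ≤ 2 * ‖x‖ := by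
  have h1 : ‖inner ℝ y x • y‖ ≤ ‖x‖ := by
    rw [norm_smul, hy, mul_one]
    have := norm_inner_le_norm (𝕜 := ℝ) y x
    rwa [hy, one_mul] at this
  exact (norm_sub_le _ _).trans (by linarith)

variable (C : E →L[ℝ] E)

lemma abs_inner_map_self_le {y : E} (hy : ‖y‖ = 1) : |inner ℝ y (C y)| ≤ ‖C‖ := by
  have h1 := abs_real_inner_le_norm y (C y)
  have h2 := C.le_opNorm y
  rw [hy] at h1 h2
  linarith

lemma abs_inner_map_self_sub_le {y y' : E} (hy : ‖y‖ = 1) (hy' : ‖y'‖ = 1) :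
    |inner ℝ y' (C y') - inner ℝ y (C y)| ≤ 2 * ‖C‖ * ‖y' - y‖ := by
  have hid : inner ℝ y' (C y') - inner ℝ y (C y) =
      (inner ℝ (y' - y) (C y') : ℝ) + inner ℝ y (C (y' - y)) := by
    rw [map_sub, inner_sub_left, inner_sub_right]; ring
  have h1 := abs_real_inner_le_norm (y' - y) (C y')
  have h2 := abs_real_inner_le_norm y (C (y' - y))
  have h3 := C.le_opNorm y'
  have h4 := C.le_opNorm (y' - y)
  rw [hy'] at h3
  rw [hy] at h2
  have h5 := mul_le_mul_of_nonneg_left h3 (norm_nonneg (y' - y))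
  rw [hid]
  exact (abs_add_le _ _).trans (by linarith)

lemma norm_tangent_sub_le {y y' : E} (hy : ‖y‖ = 1) (hy' : ‖y'‖ = 1) :
    ‖(C y' - inner ℝ y' (C y') • y') - (C y - inner ℝ y (C y) • y)‖ ≤ 4 * ‖C‖ * ‖y' - y‖ := by
  have hid : (C y' - inner ℝ y' (C y') • y') - (C y - inner ℝ y (C y) • y) =
      C (y' - y) - (inner ℝ y' (C y') • (y' - y) +
        ((inner ℝ y' (C y') : ℝ) - inner ℝ y (C y)) • y) := by
    rw [map_sub]; module
  have h1 := C.le_opNorm (y' - y)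
  have h2 : ‖(inner ℝ y' (C y') : ℝ) • (y' - y)‖ ≤ ‖C‖ * ‖y' - y‖ := by
    rw [norm_smul]
    exact mul_le_mul_of_nonneg_right (abs_inner_map_self_le C hy') (norm_nonneg _)
  have h3 : ‖((inner ℝ y' (C y') : ℝ) - inner ℝ y (C y)) • y‖ ≤ 2 * ‖C‖ * ‖y' - y‖ := by
    rw [norm_smul, hy, mul_one]
    exact abs_inner_map_self_sub_le C hy hy'
  rw [hid]
  refine (norm_sub_le _ _).trans ((add_le_add h1 ((norm_add_le _ _).trans (add_le_add h2 h3))).trans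
    (le_of_eq ?_))
  ring

/-- One Euler step in polar coordinates, with `y = z / ‖z‖`. The defect `e` bounds both the
relative remainder of the step and the square of its relative size. -/
lemma polar_step {A C : E →L[ℝ] E} {z z' : E} {τ w e hA : ℝ} (hz : z ≠ 0) (hz' : z' ≠ 0)
    (hτ : 0 ≤ τ) (hdiss : ∀ x : E, inner ℝ x (A x) ≤ -hA * ‖x‖ ^ 2)
    (he : 2 * (‖z' - z - τ • A z - w • C z‖ / ‖z‖) + 5 / 2 * (‖z' - z‖ / ‖z‖) ^ 2 ≤ e) :
    let y := ‖z‖⁻¹ • z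
    ‖‖z'‖⁻¹ • z' - y - w • (C y - inner ℝ y (C y) • y)‖ ≤ 2 * ‖A‖ * τ + e ∧
    Real.log ‖z'‖ - Real.log ‖z‖ ≤ w * inner ℝ y (C y) + (-hA * τ + e) := by
  intro y
  have hz0 : 0 < ‖z‖ := norm_pos_iff.2 hz
  have hy : ‖y‖ = 1 := by
    simp only [y, norm_smul, norm_inv, norm_norm]; exact inv_mul_cancel₀ hz0.ne'
  set h : E := ‖z‖⁻¹ • (z' - z) with hh
  set r : E := ‖z‖⁻¹ • (z' - z - τ • A z - w • C z) with hr
  have hhn : ‖h‖ = ‖z' - z‖ / ‖z‖ := by rw [hh, norm_smul, norm_inv, norm_norm, inv_mul_eq_div]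
  have hrn : ‖r‖ = ‖z' - z - τ • A z - w • C z‖ / ‖z‖ := by
    rw [hr, norm_smul, norm_inv, norm_norm, inv_mul_eq_div]
  rw [← hhn, ← hrn] at he
  have hyh : y + h = ‖z‖⁻¹ • z' := by simp only [y, hh]; module
  have hyh0 : y + h ≠ 0 := by
    rw [hyh]; exact smul_ne_zero (inv_ne_zero hz0.ne') hz'
  have hyhn : ‖y + h‖ = ‖z'‖ / ‖z‖ := by rw [hyh, norm_smul, norm_inv, norm_norm, inv_mul_eq_div]
  have hhr : h = τ • A y + w • C y + r := by
    simp only [hh, hr, y, map_smul]; module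
  have hdir : ‖z'‖⁻¹ • z' = ‖y + h‖⁻¹ • (y + h) := by
    rw [hyhn, hyh, smul_smul]; congr 1
    field_simp
  have hAy : ‖A y‖ ≤ ‖A‖ := by simpa [hy] using A.le_opNorm y
  constructor
  · have h1 := norm_normalize_add_sub_le hy hyh0
    have hid : ‖z'‖⁻¹ • z' - y - w • (C y - inner ℝ y (C y) • y) =
        (‖y + h‖⁻¹ • (y + h) - y - (h - inner ℝ y h • y)) + τ • (A y - inner ℝ y (A y) • y)
          + (r - inner ℝ y r • y) := by
      have : (inner ℝ y h : ℝ) = τ * inner ℝ y (A y) + w * inner ℝ y (C y) + inner ℝ y r := by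
        rw [hhr, inner_add_right, inner_add_right, inner_smul_right, inner_smul_right]
      rw [hdir, this]
      generalize ‖y + h‖⁻¹ • (y + h) = u
      rw [hhr]; module
    have h2 : ‖τ • (A y - inner ℝ y (A y) • y)‖ ≤ τ * (2 * ‖A‖) := by
      rw [norm_smul, Real.norm_of_nonneg hτ]
      exact mul_le_mul_of_nonneg_left ((norm_sub_inner_smul_le hy).trans (by linarith)) hτ
    have h3 := norm_sub_inner_smul_le (x := r) hy
    rw [hid]
    exact norm_add₃_le.trans (by linarith)
  · have h1 := log_norm_add_le hy hyh0
    rw [hyhn, Real.log_div (norm_ne_zero_iff.2 hz') hz0.ne', hhr, inner_add_right, inner_add_right,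
      inner_smul_right, inner_smul_right, ← hhr] at h1
    have h2 := mul_le_mul_of_nonneg_left (hdiss y) hτ
    rw [hy] at h2
    have h3 : inner ℝ y r ≤ ‖r‖ := by simpa [hy] using real_inner_le_norm y r
    nlinarith [norm_nonneg r, sq_nonneg ‖h‖]

/-- The logarithmic growth estimate for a discrete path that solves the Euler scheme of
`dz = A z dt + C z dω` up to small errors `e`. -/
theorem log_norm_sub_le_of_euler {p q hA : ℝ} {n : ℕ} (hn : 0 < n) (hp : 1 ≤ p) (hpq : p ≤ q)
    (hθ : 1 < 1 / p + 1 / q) {A C : E →L[ℝ] E}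
    (hdiss : ∀ x : E, inner ℝ x (A x) ≤ -hA * ‖x‖ ^ 2)
    {z : ℕ → E} {t ω e : ℕ → ℝ} {W : ℕ → ℕ → ℝ} (hz : ∀ i ≤ n, z i ≠ 0)
    (ht : ∀ i < n, t i ≤ t (i + 1)) (hW : IsPControl p (Set.Icc 0 n) W)
    (hω : ∀ i j, i ≤ j → j ≤ n → |ω j - ω i| ≤ W i j)
    (he : ∀ i < n, 2 * (‖z (i + 1) - z i - (t (i + 1) - t i) • A (z i)
      - (ω (i + 1) - ω i) • C (z i)‖ / ‖z i‖) + 5 / 2 * (‖z (i + 1) - z i‖ / ‖z i‖) ^ 2 ≤ e i) :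
    Real.log ‖z n‖ - Real.log ‖z 0‖ ≤ -hA * (t n - t 0) + ‖C‖ * W 0 n +
      2 * ‖C‖ * constK p q * ((2 * (2 * ‖A‖ * (t n - t 0) + ∑ i ∈ Finset.range n, e i +
        2 * ‖C‖ * W 0 n) + 2 * (2 * (4 * ‖C‖) * constK p q * W 0 n) ^ p) * W 0 n) +
      ∑ i ∈ Finset.range n, e i := by
  have hp0 : 0 < p := by linarith
  have hq0 : 0 < q := by linarith
  have hK : 0 ≤ constK p q := zero_le_one.trans (constK_ge_one hθ)
  have hmem : ∀ {k : ℕ}, k ≤ n → k ∈ Set.Icc 0 n := fun h => ⟨Nat.zero_le _, h⟩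
  set y : ℕ → E := fun i => ‖z i‖⁻¹ • z i with hy
  have hy1 : ∀ i ≤ n, ‖y i‖ = 1 := fun i hi => by
    simp only [hy, norm_smul, norm_inv, norm_norm]
    exact inv_mul_cancel₀ (norm_ne_zero_iff.2 (hz i hi))
  have hstep := fun i (hi : i < n) => polar_step (hz i hi.le) (hz (i + 1) hi)
    (sub_nonneg.2 (ht i hi)) hdiss (he i hi)
  have he0 : ∀ i < n, 0 ≤ e i := fun i hi => le_trans (by positivity) (he i hi)
  -- increments of `σ` control the drift and the errors of `y`
  set σ : ℕ → ℝ := fun i => 2 * ‖A‖ * t i + ∑ l ∈ Finset.range i, e l with hσ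
  have hσmono : MonotoneOn σ (Set.Icc 0 n) := by
    refine monotoneOn_of_le_succ Set.ordConnected_Icc fun i _ _ hi => ?_
    have hi' : i < n := hi.2
    simp only [hσ, Nat.succ_eq_succ, Nat.succ_eq_add_one, Finset.sum_range_succ]
    have := mul_le_mul_of_nonneg_left (ht i hi') (by positivity : 0 ≤ 2 * ‖A‖)
    linarith [he0 i hi']
  have hD := IsPControl.of_monotoneOn hσmono
  have hyinc : ∀ i j, i ≤ j → j ≤ n → ‖y j - y i‖ ≤ 2 * ((σ j - σ i) + 2 * ‖C‖ * W i j) +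
      2 * (2 * (4 * ‖C‖) * constK p q * W i j) ^ p := fun i j hij hj =>
    norm_sub_le_of_norm_le_one (g := fun i => C (y i) - inner ℝ (y i) (C (y i)) • y i) hp hpq hθ
      hD hW hω
      (fun i hi => (norm_sub_inner_smul_le (hy1 i hi)).trans (by
        have := C.le_opNorm (y i)
        rw [hy1 i hi] at this
        linarith))
      (by positivity)
      (fun i j hij hj => norm_tangent_sub_le C (hy1 i (hij.trans hj)) (hy1 j hj))
      (fun i hi => (hstep i hi).1.trans (le_of_eq (by
        simp only [hσ, Finset.sum_range_succ]; ring)))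
      (fun i hi => (hy1 i hi).le) hij hj
  have hF : IsPControl q (Set.Icc 0 n) (fun i j => 2 * ((σ j - σ i) + 2 * ‖C‖ * W i j) +
      2 * (2 * (4 * ‖C‖) * constK p q * W i j) ^ p) := by
    have hq1 := hp.trans hpq
    refine IsPControl.add hq1 (((hD.mono_exponent one_pos hq1).add hq1
      ((hW.mono_exponent hp0 hpq).const_mul (by positivity))).const_mul (by norm_num)) ?_
    have := (hW.const_mul (c := 2 * (4 * ‖C‖) * constK p q) (by positivity)).rpow hp0
    rw [div_self hp0.ne'] at this
    exact (this.mono_exponent one_pos hq1).const_mul (by norm_num)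
  set κ : ℕ → ℝ := fun i => inner ℝ (y i) (C (y i)) with hκ
  have hsew := norm_sum_sub_le_of_defect_le (c := 2 * ‖C‖) hp0 hq0 hθ hF hW (by positivity)
    (fun u v => (ω v - ω u) * κ u)
    (fun u hu v hv s hs huv hvs => by
      have hid : (ω v - ω u) * κ u + (ω s - ω v) * κ v - (ω s - ω u) * κ u =
          (ω s - ω v) * (κ v - κ u) := by ring
      rw [hid, norm_mul, Real.norm_eq_abs, Real.norm_eq_abs]
      refine (mul_le_mul (hω v s hvs hs.2) ((abs_inner_map_self_sub_le C (hy1 u hu.2)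
        (hy1 v hv.2)).trans (mul_le_mul_of_nonneg_left (hyinc u v huv hv.2) (by positivity)))
        (abs_nonneg _) (hW.nonneg hv hs hvs)).trans (le_of_eq ?_)
      ring)
    hn id (fun i hi => hmem hi) (fun i _ => Nat.le_succ i)
  simp only [id] at hsew
  have h0 : |(ω n - ω 0) * κ 0| ≤ W 0 n * ‖C‖ := by
    rw [abs_mul]
    exact mul_le_mul (hω 0 n (Nat.zero_le _) le_rfl)
      (abs_inner_map_self_le C (hy1 0 (Nat.zero_le _))) (abs_nonneg _)
      (hW.nonneg (hmem (Nat.zero_le _)) (hmem le_rfl) (Nat.zero_le _))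
  have hlog : Real.log ‖z n‖ - Real.log ‖z 0‖ ≤
      ∑ i ∈ Finset.range n, (ω (i + 1) - ω i) * κ i +
        (-hA * (t n - t 0) + ∑ i ∈ Finset.range n, e i) := by
    rw [← Finset.sum_range_sub (fun i => Real.log ‖z i‖), ← Finset.sum_range_sub t,
      Finset.mul_sum, ← Finset.sum_add_distrib, ← Finset.sum_add_distrib]
    exact Finset.sum_le_sum fun i hi => (hstep i (Finset.mem_range.1 hi)).2
  have h1 := (abs_le.1 hsew).2
  have h2 := (abs_le.1 h0).2
  have hσn : σ n - σ 0 = 2 * ‖A‖ * (t n - t 0) + ∑ i ∈ Finset.range n, e i := by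
    simp only [hσ, Finset.sum_range_zero]; ring
  rw [hσn] at h1
  linarith

end Sphere

/-! ### Partitions and the `p`-variation control -/

namespace Partition

variable {a b c : ℝ}

lemma monotone_pt (π : Partition a b) {i j : ℕ} (hij : i ≤ j) (hj : j ≤ π.n) :
    π.pt i ≤ π.pt j := by
  induction j, hij using Nat.le_induction with
  | base => exact le_rfl
  | succ j _ ih => exact (ih (by lia)).trans (π.lt_succ j (by lia)).le

lemma pt_mem (π : Partition a b) {i : ℕ} (hi : i ≤ π.n) : π.pt i ∈ Set.Icc a b :=
  ⟨π.pt_zero.symm.le.trans (π.monotone_pt (Nat.zero_le i) hi),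
    (π.monotone_pt hi le_rfl).trans π.pt_last.le⟩

lemma n_pos (π : Partition a b) (h : a < b) : 0 < π.n := by
  rcases Nat.eq_zero_or_pos π.n with h0 | h0
  · have h1 := π.pt_zero
    have h2 := π.pt_last
    rw [h0] at h2
    linarith
  · exact h0

/-- Concatenation of partitions of adjacent intervals. -/
def append (π : Partition a b) (ρ : Partition b c) : Partition a c where
  n := π.n + ρ.n
  pt i := if i ≤ π.n then π.pt i else ρ.pt (i - π.n)
  pt_zero := by simp [π.pt_zero]
  pt_last := by
    by_cases h : ρ.n = 0
    · have h1 := ρ.pt_zero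
      have h2 := ρ.pt_last
      rw [h] at h2
      simp [h, π.pt_last, ← h1, h2]
    · simp [h, ρ.pt_last]
  lt_succ i hi := by
    rcases lt_trichotomy i π.n with h | h | h
    · simpa [h.le, Nat.succ_le_of_lt h] using π.lt_succ i h
    · subst h
      simpa [π.pt_last, ← ρ.pt_zero] using ρ.lt_succ 0 (by lia)
    · have h3 : i + 1 - π.n = i - π.n + 1 := by lia
      simpa [not_le.2 h, not_le.2 (h.trans (Nat.lt_succ_self i)), h3] using
        ρ.lt_succ (i - π.n) (by lia)

lemma append_pt_left (π : Partition a b) (ρ : Partition b c) {i : ℕ} (hi : i ≤ π.n) :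
    (π.append ρ).pt i = π.pt i := if_pos hi

lemma append_pt_right (π : Partition a b) (ρ : Partition b c) (i : ℕ) :
    (π.append ρ).pt (π.n + i) = ρ.pt i := by
  rcases Nat.eq_zero_or_pos i with rfl | hi
  · rw [add_zero, append_pt_left _ _ le_rfl, π.pt_last, ρ.pt_zero]
  · simp [append, hi.ne']

lemma sum_append {M : Type*} [AddCommMonoid M] (π : Partition a b) (ρ : Partition b c)
    (F : ℝ → ℝ → M) :
    ∑ i ∈ Finset.range (π.append ρ).n, F ((π.append ρ).pt i) ((π.append ρ).pt (i + 1)) =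
      ∑ i ∈ Finset.range π.n, F (π.pt i) (π.pt (i + 1)) +
        ∑ i ∈ Finset.range ρ.n, F (ρ.pt i) (ρ.pt (i + 1)) := by
  change ∑ i ∈ Finset.range (π.n + ρ.n), _ = _
  rw [Finset.sum_range_add]
  congr 1
  · refine Finset.sum_congr rfl fun i hi => ?_
    have := Finset.mem_range.1 hi
    rw [append_pt_left _ _ (by lia), append_pt_left _ _ (by lia)]
  · refine Finset.sum_congr rfl fun i _ => ?_
    rw [append_pt_right, add_assoc, append_pt_right]

lemma mesh_append {η : ℝ} (π : Partition a b) (ρ : Partition b c)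
    (hπ : ∀ i < π.n, π.pt (i + 1) - π.pt i < η) (hρ : ∀ i < ρ.n, ρ.pt (i + 1) - ρ.pt i < η) :
    ∀ i < (π.append ρ).n, (π.append ρ).pt (i + 1) - (π.append ρ).pt i < η := by
  intro i hi
  have hi' : i < π.n + ρ.n := hi
  rcases lt_or_ge i π.n with h | h
  · rw [append_pt_left _ _ (by lia), append_pt_left _ _ (by lia)]
    exact hπ i h
  · obtain ⟨k, rfl⟩ := Nat.exists_eq_add_of_le h
    rw [add_assoc, append_pt_right, append_pt_right]
    exact hρ k (by lia)

/-- The partition of a point. -/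
def refl (a : ℝ) : Partition a a :=
  ⟨0, fun _ => a, rfl, rfl, fun _ h => absurd h (Nat.not_lt_zero _)⟩

/-- The partition of `[a, b]` into `m + 1` intervals of equal length. -/
noncomputable def uniform (h : a < b) (m : ℕ) : Partition a b where
  n := m + 1
  pt i := a + i * ((b - a) / (m + 1))
  pt_zero := by simp
  pt_last := by push_cast; field_simp; ring
  lt_succ i _ := by
    have : 0 < (b - a) / (m + 1) := div_pos (sub_pos.2 h) (by positivity)
    push_cast
    linarith

lemma exists_mesh_lt (h : a ≤ b) {η : ℝ} (hη : 0 < η) :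
    ∃ π : Partition a b, ∀ i < π.n, π.pt (i + 1) - π.pt i < η := by
  rcases h.eq_or_lt with rfl | h
  · exact ⟨refl a, fun i hi => absurd hi (Nat.not_lt_zero i)⟩
  · obtain ⟨m, hm⟩ := exists_nat_gt ((b - a) / η)
    refine ⟨uniform h m, fun i _ => ?_⟩
    have : (uniform h m).pt (i + 1) - (uniform h m).pt i = (b - a) / (m + 1) := by
      simp only [uniform]; push_cast; ring
    rw [this, div_lt_iff₀ (by positivity)]
    rw [div_lt_iff₀ hη] at hm
    linarith

lemma nonempty (h : a ≤ b) : Nonempty (Partition a b) :=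
  ⟨(exists_mesh_lt h one_pos).choose⟩

end Partition

section PVar

variable {E : Type*} [NormedAddCommGroup E] {p a b : ℝ} {x : ℝ → E}

lemma ePVar_rpow (hp : 0 < p) (u v : ℝ) :
    ePVar p x u v ^ p = ⨆ π : Partition u v,
      ∑ i ∈ Finset.range π.n, ENNReal.ofReal (‖x (π.pt (i + 1)) - x (π.pt i)‖ ^ p) := by
  rw [ePVar, ← ENNReal.rpow_mul, one_div_mul_cancel hp.ne', ENNReal.rpow_one]

lemma ePVar_rpow_add_le (hp : 0 < p) {u v s : ℝ} (huv : u ≤ v) (hvs : v ≤ s) :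
    ePVar p x u v ^ p + ePVar p x v s ^ p ≤ ePVar p x u s ^ p := by
  have := Partition.nonempty huv
  have := Partition.nonempty hvs
  simp only [ePVar_rpow hp]
  refine ENNReal.iSup_add_iSup_le fun π ρ => ?_
  rw [← Partition.sum_append π ρ fun s t => ENNReal.ofReal (‖x t - x s‖ ^ p)]
  exact le_iSup (fun π : Partition u s => ∑ i ∈ Finset.range π.n,
    ENNReal.ofReal (‖x (π.pt (i + 1)) - x (π.pt i)‖ ^ p)) (π.append ρ)

lemma ePVar_ne_top (hp : 0 < p) (hx : ePVar p x a b < ⊤) {u v : ℝ} (hu : a ≤ u) (huv : u ≤ v)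
    (hv : v ≤ b) : ePVar p x u v ≠ ⊤ := by
  have h1 : ePVar p x u v ^ p ≤ ePVar p x a b ^ p :=
    (le_add_self.trans (ePVar_rpow_add_le hp hu huv)).trans
      (le_self_add.trans (ePVar_rpow_add_le hp (hu.trans huv) hv))
  exact (((ENNReal.rpow_le_rpow_iff hp).1 h1).trans_lt hx).ne

lemma isPControl_pVar (hp : 0 < p) (hx : ePVar p x a b < ⊤) :
    IsPControl p (Set.Icc a b) (pVar p x) := by
  refine ⟨fun _ _ _ _ _ => ENNReal.toReal_nonneg, fun u v s hu hv hs huv hvs => ?_⟩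
  simp only [pVar, ENNReal.toReal_rpow]
  rw [← ENNReal.toReal_add (ENNReal.rpow_ne_top_of_nonneg hp.le (ePVar_ne_top hp hx hu.1 huv hv.2))
    (ENNReal.rpow_ne_top_of_nonneg hp.le (ePVar_ne_top hp hx hv.1 hvs hs.2))]
  exact ENNReal.toReal_mono
    (ENNReal.rpow_ne_top_of_nonneg hp.le (ePVar_ne_top hp hx hu.1 (huv.trans hvs) hs.2))
    (ePVar_rpow_add_le hp huv hvs)

lemma norm_sub_le_pVar (hp : 0 < p) (hx : ePVar p x a b < ⊤) {u v : ℝ} (hu : a ≤ u) (huv : u ≤ v)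
    (hv : v ≤ b) : ‖x v - x u‖ ≤ pVar p x u v := by
  rcases huv.eq_or_lt with rfl | h
  · rw [sub_self, norm_zero]
    exact ENNReal.toReal_nonneg
  have htop := ePVar_ne_top hp hx hu huv hv
  have h1 : ENNReal.ofReal (‖x v - x u‖ ^ p) ≤ ePVar p x u v ^ p := by
    rw [ePVar_rpow hp]
    refine le_trans (le_of_eq ?_) (le_iSup (fun π : Partition u v => ∑ i ∈ Finset.range π.n,
      ENNReal.ofReal (‖x (π.pt (i + 1)) - x (π.pt i)‖ ^ p)) (Partition.uniform h 0))
    simp [Partition.uniform]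
  rw [← ENNReal.ofReal_rpow_of_nonneg (norm_nonneg _) hp.le, ENNReal.rpow_le_rpow_iff hp] at h1
  exact (ENNReal.ofReal_le_iff_le_toReal htop).1 h1

end PVar

/-! ### Increments of the Young integral -/

section Integral

variable {E F : Type*} [NormedAddCommGroup E] [NormedSpace ℝ E] [NormedAddCommGroup F]
  [NormedSpace ℝ F] {ξ : ℝ → E} {ω : ℝ → ℝ} {a b : ℝ} {I : E}

lemma HasIntegral.map (h : HasIntegral ξ ω a b I) (ℓ : E →L[ℝ] F) :
    HasIntegral (fun s => ℓ (ξ s)) ω a b (ℓ I) := by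
  intro ε hε
  obtain ⟨η, hη, hI⟩ := h (ε / (‖ℓ‖ + 1)) (by positivity)
  refine ⟨η, hη, fun π hπ => ?_⟩
  have h1 := hI π hπ
  have h2 : ∑ i ∈ Finset.range π.n, (ω (π.pt (i + 1)) - ω (π.pt i)) • ℓ (ξ (π.pt i)) - ℓ I =
      ℓ (∑ i ∈ Finset.range π.n, (ω (π.pt (i + 1)) - ω (π.pt i)) • ξ (π.pt i) - I) := by
    simp only [map_sub, map_sum, map_smul]
  rw [h2]
  rw [lt_div_iff₀ (by positivity)] at h1
  have h3 := ℓ.le_opNorm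
    (∑ i ∈ Finset.range π.n, (ω (π.pt (i + 1)) - ω (π.pt i)) • ξ (π.pt i) - I)
  refine h3.trans_lt (lt_of_le_of_lt ?_ h1)
  nlinarith [norm_nonneg
    (∑ i ∈ Finset.range π.n, (ω (π.pt (i + 1)) - ω (π.pt i)) • ξ (π.pt i) - I)]

/-- A bound for the left-point sums over `[u, v]` passes to the increment over `[u, v]` of the
Young integral, since a fine partition of `[u, v]` extends to a fine partition of `[a, v]`. -/
lemma HasIntegral.norm_increment_sub_le {u v B : ℝ} {J : E} (hI : HasIntegral ξ ω a u I)
    (hJ : HasIntegral ξ ω a v J) (hau : a ≤ u) (huv : u ≤ v)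
    (hB : ∀ π : Partition u v, ‖∑ i ∈ Finset.range π.n,
      (ω (π.pt (i + 1)) - ω (π.pt i)) • ξ (π.pt i) - (ω v - ω u) • ξ u‖ ≤ B) :
    ‖J - I - (ω v - ω u) • ξ u‖ ≤ B := by
  refine le_of_forall_pos_le_add fun ε hε => ?_
  obtain ⟨η₁, hη₁, h₁⟩ := hI (ε / 2) (by positivity)
  obtain ⟨η₂, hη₂, h₂⟩ := hJ (ε / 2) (by positivity)
  obtain ⟨π, hπ⟩ := Partition.exists_mesh_lt hau (lt_min hη₁ hη₂)
  obtain ⟨ρ, hρ⟩ := Partition.exists_mesh_lt huv (lt_min hη₁ hη₂)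
  have e1 := h₁ π fun i hi => (hπ i hi).trans_le (min_le_left _ _)
  have e2 := h₂ (π.append ρ) (Partition.mesh_append π ρ
    (fun i hi => (hπ i hi).trans_le (min_le_right _ _))
    (fun i hi => (hρ i hi).trans_le (min_le_right _ _)))
  rw [Partition.sum_append π ρ fun s t => (ω t - ω s) • ξ s] at e2
  have e3 := hB ρ
  set X := ∑ i ∈ Finset.range π.n, (ω (π.pt (i + 1)) - ω (π.pt i)) • ξ (π.pt i)
  set Y := ∑ i ∈ Finset.range ρ.n, (ω (ρ.pt (i + 1)) - ω (ρ.pt i)) • ξ (ρ.pt i)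
  have hid : J - I - (ω v - ω u) • ξ u = (Y - (ω v - ω u) • ξ u) + (X - I) - (X + Y - J) := by abel
  rw [hid]
  exact (norm_sub_le _ _).trans (by linarith [norm_add_le (Y - (ω v - ω u) • ξ u) (X - I)])

/-- The local error of the Euler scheme for `X t = X 0 + ∫ α ds + ∫ ξ dω`. -/
lemma norm_euler_remainder_le [CompleteSpace E] {p q T u v ε c : ℝ} {X α : ℝ → E}
    {f g : ℝ → ℝ → ℝ} (hp : 0 < p) (hq : 0 < q) (hθ : 1 < 1 / p + 1 / q)
    (hα : ContinuousOn α (Set.Icc 0 T))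
    (hX : ∀ t ∈ Set.Icc 0 T, HasIntegral ξ ω 0 t (X t - X 0 - ∫ s in (0 : ℝ)..t, α s))
    (hu : 0 ≤ u) (huv : u < v) (hv : v ≤ T) (hε : ∀ s ∈ Set.Icc u v, ‖α s - α u‖ ≤ ε)
    (hf : IsPControl q (Set.Icc u v) f) (hg : IsPControl p (Set.Icc u v) g) (hc : 0 ≤ c)
    (hξf : ∀ s ∈ Set.Icc u v, ∀ t ∈ Set.Icc u v, s ≤ t → ‖ξ t - ξ s‖ ≤ c * f s t)
    (hωg : ∀ s ∈ Set.Icc u v, ∀ t ∈ Set.Icc u v, s ≤ t → |ω t - ω s| ≤ g s t) :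
    ‖X v - X u - (v - u) • α u - (ω v - ω u) • ξ u‖ ≤
      ε * (v - u) + c * constK p q * (f u v * g u v) := by
  have hint : ∀ {r s : ℝ}, 0 ≤ r → r ≤ T → 0 ≤ s → s ≤ T →
      IntervalIntegrable α MeasureTheory.volume r s := fun hr hr' hs hs' =>
    (hα.mono (Set.uIcc_subset_Icc ⟨hr, hr'⟩ ⟨hs, hs'⟩)).intervalIntegrable
  have hT : 0 ≤ T := by linarith
  have h1 := HasIntegral.norm_increment_sub_le (B := c * constK p q * (f u v * g u v))
    (hX u ⟨hu, by linarith⟩) (hX v ⟨by linarith, hv⟩) hu huv.le (fun π => by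
      have := norm_sum_sub_le_of_defect_le hp hq hθ hf hg hc (fun s t => (ω t - ω s) • ξ s)
        (fun r hr s hs t ht hrs hst => by
          have hid : (ω s - ω r) • ξ r + (ω t - ω s) • ξ s - (ω t - ω r) • ξ r =
            (ω t - ω s) • (ξ s - ξ r) := by module
          rw [hid, norm_smul, Real.norm_eq_abs]
          refine (mul_le_mul (hωg s hs t ht hst) (hξf r hr s hs hrs) (norm_nonneg _)
            (hg.nonneg hs ht hst)).trans (le_of_eq ?_)
          ring)
        (π.n_pos huv) π.pt (fun i hi => π.pt_mem hi) (fun i hi => (π.lt_succ i hi).le)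
      rwa [π.pt_zero, π.pt_last] at this)
  have h2 : (∫ s in (0 : ℝ)..v, α s) - (∫ s in (0 : ℝ)..u, α s) - (v - u) • α u =
      ∫ s in u..v, (α s - α u) := by
    rw [intervalIntegral.integral_interval_sub_left (hint le_rfl hT (by linarith) hv)
      (hint le_rfl hT hu (by linarith)), intervalIntegral.integral_sub
      (hint hu (by linarith) (by linarith) hv) (by simp), intervalIntegral.integral_const]
  have h3 : ‖∫ s in u..v, (α s - α u)‖ ≤ ε * (v - u) := by
    have := intervalIntegral.norm_integral_le_of_norm_le_const (a := u) (b := v) (C := ε)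
      (f := fun s => α s - α u) (fun s hs => by
        rw [Set.uIoc_of_le huv.le] at hs
        exact hε s ⟨hs.1.le, hs.2⟩)
    rwa [abs_of_pos (sub_pos.2 huv)] at this
  have hid : X v - X u - (v - u) • α u - (ω v - ω u) • ξ u =
      (X v - X 0 - (∫ s in (0 : ℝ)..v, α s) - (X u - X 0 - ∫ s in (0 : ℝ)..u, α s)
        - (ω v - ω u) • ξ u) +
      ((∫ s in (0 : ℝ)..v, α s) - (∫ s in (0 : ℝ)..u, α s) - (v - u) • α u) := by abel
  rw [hid]
  refine (norm_add_le _ _).trans ?_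
  rw [h2]
  linarith

end Integral

/-! ### Fine partitions make the total Euler defect small -/

/-- Hölder's inequality for controls with `1 / p + 1 / q ≥ 1`. -/
lemma IsPControl.sum_mul_le {α : Type*} [Preorder α] {p q : ℝ} {S : Set α} {f g : α → α → ℝ}
    (hp : 0 < p) (hq : 1 < q) (hθ : 1 ≤ 1 / p + 1 / q) (hf : IsPControl q S f)
    (hg : IsPControl p S g) {n : ℕ} (s : ℕ → α) (hs : ∀ i ≤ n, s i ∈ S)
    (hmono : ∀ i < n, s i ≤ s (i + 1)) (h0n : s 0 ≤ s n) :
    ∑ i ∈ Finset.range n, f (s i) (s (i + 1)) * g (s i) (s (i + 1)) ≤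
      f (s 0) (s n) * g (s 0) (s n) := by
  have hconj := Real.HolderConjugate.conjExponent hq
  set r := Real.conjExponent q
  have hr0 : 0 < r := hconj.symm.pos
  have hpr : p ≤ r := by
    have h1 := hconj.inv_add_inv_eq_one
    simp only [one_div] at hθ
    exact (inv_le_inv₀ hr0 hp).1 (by linarith)
  have hg' := hg.mono_exponent hp hpr
  have hfn : ∀ i < n, 0 ≤ f (s i) (s (i + 1)) := fun i hi =>
    hf.nonneg (hs i hi.le) (hs (i + 1) hi) (hmono i hi)
  have hgn : ∀ i < n, 0 ≤ g (s i) (s (i + 1)) := fun i hi =>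
    hg.nonneg (hs i hi.le) (hs (i + 1) hi) (hmono i hi)
  have hroot : ∀ {x y t : ℝ}, 0 < t → 0 ≤ x → 0 ≤ y → x ≤ y ^ t → x ^ (1 / t) ≤ y :=
    fun {x y t} ht hx hy h => by
      have := Real.rpow_le_rpow hx h (by positivity : 0 ≤ 1 / t)
      rwa [← Real.rpow_mul hy, mul_one_div_cancel ht.ne', Real.rpow_one] at this
  refine (Real.inner_le_Lp_mul_Lq_of_nonneg _ hconj
    (fun i hi => hfn i (Finset.mem_range.1 hi))
    (fun i hi => hgn i (Finset.mem_range.1 hi))).trans ?_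
  refine mul_le_mul (hroot (by linarith) (Finset.sum_nonneg fun i hi =>
      Real.rpow_nonneg (hfn i (Finset.mem_range.1 hi)) _)
      (hf.nonneg (hs 0 (by lia)) (hs n le_rfl) h0n)
      (hf.sum_rpow_le s hs hmono))
    (hroot hr0 (Finset.sum_nonneg fun i hi =>
      Real.rpow_nonneg (hgn i (Finset.mem_range.1 hi)) _)
      (hg.nonneg (hs 0 (by lia)) (hs n le_rfl) h0n)
      (hg'.sum_rpow_le s hs hmono)) (Real.rpow_nonneg (Finset.sum_nonneg fun i hi =>
      Real.rpow_nonneg (hgn i (Finset.mem_range.1 hi)) _) _)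
    (hf.nonneg (hs 0 (by lia)) (hs n le_rfl) h0n)

lemma exists_exponent_between {p q : ℝ} (hp1 : 1 < p) (hp2 : p < 2) (hθ : 1 < 1 / p + 1 / q) :
    ∃ r, p < r ∧ r ≤ 2 ∧ 1 < 1 / r + 1 / q := by
  obtain ⟨y, hy1, hy2⟩ := exists_between (a₁ := max (1 / 2) (1 - 1 / q)) (a₂ := 1 / p)
    (max_lt (one_div_lt_one_div_of_lt (by linarith) hp2) (by linarith))
  have h1 := (le_max_left _ _).trans_lt hy1
  have h2 := (le_max_right _ _).trans_lt hy1
  have hy0 : 0 < y := by linarith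
  refine ⟨1 / y, (lt_one_div (by linarith) hy0).2 hy2, ?_, by rw [one_div_one_div]; linarith⟩
  rw [div_le_iff₀ hy0]
  linarith

/-- A uniformly continuous path oscillates little over short time intervals. -/
lemma exists_forall_norm_sub_le {E : Type*} [NormedAddCommGroup E] {x : ℝ → E} {T κ : ℝ}
    (hx : ContinuousOn x (Set.Icc 0 T)) (hκ : 0 < κ) :
    ∃ η > 0, ∀ u ∈ Set.Icc 0 T, ∀ v ∈ Set.Icc 0 T, |v - u| < η → ‖x v - x u‖ ≤ κ := by
  obtain ⟨η, hη, h⟩ := Metric.uniformContinuousOn_iff.1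
    (isCompact_Icc.uniformContinuousOn_of_continuous hx) κ hκ
  refine ⟨η, hη, fun u hu v hv huv => ?_⟩
  rw [← dist_eq_norm]
  exact (h v hv u hu (by rwa [Real.dist_eq])).le

lemma add_add_sq_le (x y z : ℝ) : (x + y + z) ^ 2 ≤ 3 * (x ^ 2 + y ^ 2 + z ^ 2) := by
  nlinarith [sq_nonneg (x - y), sq_nonneg (x - z), sq_nonneg (y - z)]

/-- For a solution of `dX = A X dt + C X dω`, the Euler remainders and the squared increments have
arbitrarily small sums over suitable partitions. The driving path is viewed as a path of finite
`r`-variation for some `r` slightly larger than `p`: over short time intervals its `r`-variation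
is at most `κ ^ (1 - p / r)` times a power of its `p`-variation, with `κ` the oscillation. -/
theorem exists_partition_defect_le {E : Type*} [NormedAddCommGroup E] [NormedSpace ℝ E]
    [CompleteSpace E] {p q T a b m ε : ℝ} (hp1 : 1 < p) (hp2 : p < 2) (hpq : p ≤ q)
    (hθ : 1 < 1 / p + 1 / q) {ω : ℝ → ℝ} (hω : MemCPVar p ω 0 T) {A C : E →L[ℝ] E} {X : ℝ → E}
    {f : ℝ → ℝ → ℝ} (hXc : ContinuousOn X (Set.Icc 0 T)) (hf : IsPControl q (Set.Icc 0 T) f)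
    (hXf : ∀ u ∈ Set.Icc 0 T, ∀ v ∈ Set.Icc 0 T, u ≤ v → ‖X v - X u‖ ≤ f u v)
    (hX : ∀ t ∈ Set.Icc 0 T,
      HasIntegral (fun s => C (X s)) ω 0 t (X t - X 0 - ∫ s in (0 : ℝ)..t, A (X s)))
    (ha : 0 ≤ a) (hab : a < b) (hb : b ≤ T) (hm : 0 < m) (hε : 0 < ε) :
    ∃ π : Partition a b, ∑ i ∈ Finset.range π.n,
      (2 * (‖X (π.pt (i + 1)) - X (π.pt i) - (π.pt (i + 1) - π.pt i) • A (X (π.pt i))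
        - (ω (π.pt (i + 1)) - ω (π.pt i)) • C (X (π.pt i))‖ / m) +
        5 / 2 * (‖X (π.pt (i + 1)) - X (π.pt i)‖ / m) ^ 2) ≤ ε := by
  obtain ⟨r, hpr, hr2, hrθ⟩ := exists_exponent_between hp1 hp2 hθ
  have hp0 : 0 < p := by linarith
  have hr0 : 0 < r := by linarith
  have hq1 : 1 < q := by linarith
  have hsub : Set.Icc a b ⊆ Set.Icc 0 T := Set.Icc_subset_Icc ha hb
  obtain ⟨M, hM⟩ := isCompact_Icc.exists_bound_of_continuousOn hXc
  set s := 1 - p / r with hs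
  have hs0 : 0 < s := sub_pos.2 ((div_lt_one hr0).2 hpr)
  have hW := isPControl_pVar hp0 hω.2
  set w := pVar p ω a b ^ (p / r)
  -- `R κ` bounds the sum of the Euler remainders, `B κ` the sum in the statement
  set R : ℝ → ℝ := fun κ => κ * (b - a) + ‖C‖ * constK r q * (f a b * (κ ^ s * w)) with hR
  set B : ℝ → ℝ := fun κ => 2 / m * R κ + 5 / 2 / m ^ 2 * (3 * (‖A‖ ^ 2 * M ^ 2 * (κ * (b - a)) +
    ‖C‖ ^ 2 * M ^ 2 * (κ ^ s * w) ^ 2 + R κ ^ 2)) with hBdef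
  have hB0 : Filter.Tendsto B (nhds 0) (nhds 0) := by
    have hc : ContinuousAt (fun κ : ℝ => κ ^ s) 0 :=
      Real.continuousAt_rpow_const 0 s (Or.inr hs0.le)
    have hBc : ContinuousAt B 0 := by
      simp only [hBdef, hR]
      fun_prop
    have : B 0 = 0 := by simp [hBdef, hR, Real.zero_rpow hs0.ne']
    simpa [ContinuousAt, this] using hBc
  obtain ⟨κ, hκB, hκ⟩ : ∃ κ, B κ < ε ∧ 0 < κ :=
    (((hB0.mono_left nhdsWithin_le_nhds).eventually_lt_const hε).and
      (self_mem_nhdsWithin : Set.Ioi (0 : ℝ) ∈ nhdsWithin 0 (Set.Ioi 0))).exists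
  obtain ⟨η₁, hη₁, hω₁⟩ := exists_forall_norm_sub_le hω.1 hκ
  obtain ⟨η₂, hη₂, hX₂⟩ := exists_forall_norm_sub_le (A.continuous.comp_continuousOn hXc) hκ
  obtain ⟨π, hπ⟩ := Partition.exists_mesh_lt hab.le (lt_min (lt_min hη₁ hη₂) hκ)
  have hπ₁ : ∀ i < π.n, π.pt (i + 1) - π.pt i < η₁ := fun i hi =>
    (hπ i hi).trans_le ((min_le_left _ _).trans (min_le_left _ _))
  have hπ₂ : ∀ i < π.n, π.pt (i + 1) - π.pt i < η₂ := fun i hi =>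
    (hπ i hi).trans_le ((min_le_left _ _).trans (min_le_right _ _))
  have hπ₃ : ∀ i < π.n, π.pt (i + 1) - π.pt i ≤ κ := fun i hi =>
    (hπ i hi).le.trans (min_le_right _ _)
  have hmem : ∀ i ≤ π.n, π.pt i ∈ Set.Icc 0 T := fun i hi => hsub (π.pt_mem hi)
  have hmono : ∀ i < π.n, π.pt i ≤ π.pt (i + 1) := fun i hi => (π.lt_succ i hi).le
  -- an `r`-control, which dominates the increments of `ω` over short intervals
  set g : ℝ → ℝ → ℝ := fun u v => κ ^ s * pVar p ω u v ^ (p / r) with hg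
  have hgc : IsPControl r (Set.Icc 0 T) g := by
    have h := (hW.rpow (r := p / r) (by positivity)).const_mul (c := κ ^ s) (by positivity)
    rwa [div_div_cancel₀ hp0.ne'] at h
  have hωg : ∀ u ∈ Set.Icc 0 T, ∀ v ∈ Set.Icc 0 T, u ≤ v → v - u < η₁ → |ω v - ω u| ≤ g u v := by
    intro u hu v hv huv hη
    have h1 : |ω v - ω u| ≤ κ := hω₁ u hu v hv (by rwa [abs_of_nonneg (sub_nonneg.2 huv)])
    have h2 : |ω v - ω u| ≤ pVar p ω u v := norm_sub_le_pVar hp0 hω.2 hu.1 huv hv.2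
    calc |ω v - ω u| = |ω v - ω u| ^ s * |ω v - ω u| ^ (p / r) := by
          rw [← Real.rpow_add' (abs_nonneg _) (by simp [hs]), hs, sub_add_cancel, Real.rpow_one]
      _ ≤ κ ^ s * pVar p ω u v ^ (p / r) := by gcongr
  set ρ : ℕ → ℝ := fun i => ‖X (π.pt (i + 1)) - X (π.pt i) -
    (π.pt (i + 1) - π.pt i) • A (X (π.pt i)) - (ω (π.pt (i + 1)) - ω (π.pt i)) • C (X (π.pt i))‖
    with hρ
  have hρle : ∀ i < π.n, ρ i ≤ κ * (π.pt (i + 1) - π.pt i) +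
      ‖C‖ * constK r q * (f (π.pt i) (π.pt (i + 1)) * g (π.pt i) (π.pt (i + 1))) := by
    intro i hi
    have hsub' : Set.Icc (π.pt i) (π.pt (i + 1)) ⊆ Set.Icc 0 T :=
      Set.Icc_subset_Icc (hmem i hi.le).1 (hmem (i + 1) hi).2
    refine norm_euler_remainder_le hr0 (by linarith) hrθ (A.continuous.comp_continuousOn hXc) hX
      (hmem i hi.le).1 (π.lt_succ i hi) (hmem (i + 1) hi).2 (fun t ht => ?_) (hf.subset hsub')
      (hgc.subset hsub') (norm_nonneg C) (fun u hu v hv huv => ?_) (fun u hu v hv huv => ?_)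
    · refine hX₂ _ (hmem i hi.le) t (hsub' ht) ?_
      rw [abs_of_nonneg (sub_nonneg.2 ht.1)]
      linarith [ht.2, hπ₂ i hi]
    · rw [← map_sub]
      exact (C.le_opNorm _).trans
        (mul_le_mul_of_nonneg_left (hXf u (hsub' hu) v (hsub' hv) huv) (norm_nonneg _))
    · exact hωg u (hsub' hu) v (hsub' hv) huv (by linarith [hu.1, hv.2, hπ₁ i hi])
  have hlen : ∑ i ∈ Finset.range π.n, (π.pt (i + 1) - π.pt i) = b - a := by
    rw [Finset.sum_range_sub, π.pt_last, π.pt_zero]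
  have h0n : π.pt 0 ≤ π.pt π.n := π.monotone_pt (Nat.zero_le _) le_rfl
  have hρsum : ∑ i ∈ Finset.range π.n, ρ i ≤ R κ := by
    refine (Finset.sum_le_sum fun i hi => hρle i (Finset.mem_range.1 hi)).trans ?_
    rw [Finset.sum_add_distrib, ← Finset.mul_sum, ← Finset.mul_sum, hlen]
    have := IsPControl.sum_mul_le hr0 hq1 hrθ.le hf hgc π.pt hmem hmono h0n
    rw [π.pt_zero, π.pt_last] at this
    have hK : 0 ≤ constK r q := zero_le_one.trans (constK_ge_one hrθ)
    simp only [hR]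
    gcongr
  have hρ0 : ∀ i, 0 ≤ ρ i := fun i => norm_nonneg _
  have hρsq : ∑ i ∈ Finset.range π.n, ρ i ^ 2 ≤ R κ ^ 2 :=
    (Finset.sum_sq_le_sq_sum_of_nonneg fun i _ => hρ0 i).trans
      (pow_le_pow_left₀ (Finset.sum_nonneg fun i _ => hρ0 i) hρsum 2)
  have hωsq : ∑ i ∈ Finset.range π.n, |ω (π.pt (i + 1)) - ω (π.pt i)| ^ 2 ≤ (κ ^ s * w) ^ 2 := by
    have h1 := (hgc.mono_exponent hr0 hr2).sum_rpow_le π.pt hmem hmono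
    simp only [Real.rpow_two, π.pt_zero, π.pt_last] at h1
    refine le_trans (Finset.sum_le_sum fun i hi => ?_) h1
    have hi := Finset.mem_range.1 hi
    exact pow_le_pow_left₀ (abs_nonneg _)
      (hωg _ (hmem i hi.le) _ (hmem (i + 1) hi) (hmono i hi) (hπ₁ i hi)) 2
  have hXsq : ∀ i < π.n, ‖X (π.pt (i + 1)) - X (π.pt i)‖ ^ 2 ≤
      3 * (‖A‖ ^ 2 * M ^ 2 * (κ * (π.pt (i + 1) - π.pt i)) +
        ‖C‖ ^ 2 * M ^ 2 * |ω (π.pt (i + 1)) - ω (π.pt i)| ^ 2 + ρ i ^ 2) := by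
    intro i hi
    set τ := π.pt (i + 1) - π.pt i with hτ
    have hτ0 : 0 ≤ τ := sub_nonneg.2 (hmono i hi)
    have hMi := hM _ (hmem i hi.le)
    set d := |ω (π.pt (i + 1)) - ω (π.pt i)| with hd
    have hd0 : 0 ≤ d := abs_nonneg _
    have h1 : ‖τ • A (X (π.pt i))‖ ≤ τ * (‖A‖ * M) := by
      rw [norm_smul, Real.norm_of_nonneg hτ0]
      exact mul_le_mul_of_nonneg_left ((A.le_opNorm _).trans
        (mul_le_mul_of_nonneg_left hMi (norm_nonneg _))) hτ0
    have h2 : ‖(ω (π.pt (i + 1)) - ω (π.pt i)) • C (X (π.pt i))‖ ≤ d * (‖C‖ * M) := by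
      rw [norm_smul]
      exact mul_le_mul_of_nonneg_left ((C.le_opNorm _).trans
        (mul_le_mul_of_nonneg_left hMi (norm_nonneg _))) hd0
    have hid : X (π.pt (i + 1)) - X (π.pt i) = τ • A (X (π.pt i)) +
        (ω (π.pt (i + 1)) - ω (π.pt i)) • C (X (π.pt i)) + (X (π.pt (i + 1)) - X (π.pt i) -
        τ • A (X (π.pt i)) - (ω (π.pt (i + 1)) - ω (π.pt i)) • C (X (π.pt i))) := by abel
    have h3 : ‖X (π.pt (i + 1)) - X (π.pt i)‖ ≤ τ * (‖A‖ * M) + d * (‖C‖ * M) + ρ i := by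
      rw [hid]
      exact norm_add₃_le.trans (by simp only [hρ]; linarith)
    have h4 : τ ^ 2 ≤ κ * τ := by rw [sq]; exact mul_le_mul_of_nonneg_right (hπ₃ i hi) hτ0
    have h5 := add_add_sq_le (τ * (‖A‖ * M)) (d * (‖C‖ * M)) (ρ i)
    have h6 := mul_le_mul_of_nonneg_left h4 (by positivity : 0 ≤ ‖A‖ ^ 2 * M ^ 2)
    refine (pow_le_pow_left₀ (norm_nonneg _) h3 2).trans (h5.trans ?_)
    linarith
  have hsplit : ∑ i ∈ Finset.range π.n, (2 * (ρ i / m) +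
      5 / 2 * (‖X (π.pt (i + 1)) - X (π.pt i)‖ / m) ^ 2) =
      2 / m * ∑ i ∈ Finset.range π.n, ρ i + 5 / 2 / m ^ 2 *
        ∑ i ∈ Finset.range π.n, ‖X (π.pt (i + 1)) - X (π.pt i)‖ ^ 2 := by
    rw [Finset.mul_sum, Finset.mul_sum, ← Finset.sum_add_distrib]
    refine Finset.sum_congr rfl fun i _ => ?_
    rw [div_pow]; ring
  refine ⟨π, hsplit.le.trans (le_trans ?_ hκB.le)⟩
  have h1 : ∑ i ∈ Finset.range π.n, ‖X (π.pt (i + 1)) - X (π.pt i)‖ ^ 2 ≤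
      3 * (‖A‖ ^ 2 * M ^ 2 * (κ * (b - a)) + ‖C‖ ^ 2 * M ^ 2 * (κ ^ s * w) ^ 2 + R κ ^ 2) := by
    refine (Finset.sum_le_sum fun i hi => hXsq i (Finset.mem_range.1 hi)).trans ?_
    rw [← Finset.mul_sum, Finset.sum_add_distrib, Finset.sum_add_distrib, ← Finset.mul_sum,
      ← Finset.mul_sum, ← Finset.mul_sum, hlen]
    gcongr
  simp only [hBdef]
  gcongr

/-! ### Exponential bounds for dissipative linear Young equations -/

section Growth

variable {E : Type*} [NormedAddCommGroup E] [InnerProductSpace ℝ E] [CompleteSpace E]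

/-- The logarithmic growth estimate on an interval on which the solution does not vanish. -/
theorem log_norm_sub_le {p q T a b hA : ℝ} (hp1 : 1 < p) (hp2 : p < 2) (hpq : p ≤ q)
    (hθ : 1 < 1 / p + 1 / q) {ω : ℝ → ℝ} (hω : MemCPVar p ω 0 T) {A C : E →L[ℝ] E} {X : ℝ → E}
    (hdiss : ∀ x : E, inner ℝ x (A x) ≤ -hA * ‖x‖ ^ 2)
    {f : ℝ → ℝ → ℝ} (hXc : ContinuousOn X (Set.Icc 0 T)) (hf : IsPControl q (Set.Icc 0 T) f)
    (hXf : ∀ u ∈ Set.Icc 0 T, ∀ v ∈ Set.Icc 0 T, u ≤ v → ‖X v - X u‖ ≤ f u v)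
    (hX : ∀ t ∈ Set.Icc 0 T,
      HasIntegral (fun s => C (X s)) ω 0 t (X t - X 0 - ∫ s in (0 : ℝ)..t, A (X s)))
    (ha : 0 ≤ a) (hab : a < b) (hb : b ≤ T) (hne : ∀ s ∈ Set.Icc a b, X s ≠ 0) :
    Real.log ‖X b‖ - Real.log ‖X a‖ ≤ -hA * (b - a) + (‖C‖ * pVar p ω a b +
      2 * ‖C‖ * constK p q * ((2 * (2 * ‖A‖ * (b - a) + 2 * ‖C‖ * pVar p ω a b) +
        2 * (2 * (4 * ‖C‖) * constK p q * pVar p ω a b) ^ p) * pVar p ω a b)) := by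
  have hp0 : 0 < p := by linarith
  have hsub : Set.Icc a b ⊆ Set.Icc 0 T := Set.Icc_subset_Icc ha hb
  have hK : 0 ≤ constK p q := zero_le_one.trans (constK_ge_one hθ)
  set W := pVar p ω a b with hW
  have hW0 : 0 ≤ W := ENNReal.toReal_nonneg
  obtain ⟨c, hc, hmin⟩ := isCompact_Icc.exists_isMinOn (Set.nonempty_Icc.2 hab.le)
    (hXc.mono hsub).norm
  have hm : 0 < ‖X c‖ := norm_pos_iff.2 (hne c hc)
  refine le_of_forall_pos_le_add fun ε hε => ?_
  -- the total Euler error enters the discrete estimate with this factor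
  have hfac : 0 < 4 * ‖C‖ * constK p q * W + 1 := by positivity
  obtain ⟨π, hπ⟩ := exists_partition_defect_le hp1 hp2 hpq hθ hω hXc hf hXf hX ha hab hb hm
    (div_pos hε hfac)
  have hmem : ∀ i ≤ π.n, π.pt i ∈ Set.Icc a b := fun i hi => π.pt_mem hi
  set e : ℕ → ℝ := fun i =>
    2 * (‖X (π.pt (i + 1)) - X (π.pt i) - (π.pt (i + 1) - π.pt i) • A (X (π.pt i))
      - (ω (π.pt (i + 1)) - ω (π.pt i)) • C (X (π.pt i))‖ / ‖X c‖) +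
      5 / 2 * (‖X (π.pt (i + 1)) - X (π.pt i)‖ / ‖X c‖) ^ 2 with he
  have h := log_norm_sub_le_of_euler (C := C) (e := e) (z := fun i => X (π.pt i)) (t := π.pt)
    (ω := fun i => ω (π.pt i)) (W := fun i j => pVar p ω (π.pt i) (π.pt j)) (n := π.n)
    (π.n_pos hab) hp1.le hpq hθ hdiss (fun i hi => hne _ (hmem i hi))
    (fun i hi => (π.lt_succ i hi).le)
    ((isPControl_pVar hp0 hω.2).comp π.pt (fun i hi => hsub (hmem i hi.2))
      fun i _ j hj hij => π.monotone_pt hij hj.2)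
    (fun i j hij hj => norm_sub_le_pVar hp0 hω.2 (hsub (hmem i (hij.trans hj))).1
      (π.monotone_pt hij hj) (hsub (hmem j hj)).2)
    (fun i hi => by
      have : ‖X c‖ ≤ ‖X (π.pt i)‖ := hmin (hmem i hi.le)
      simp only [he]
      gcongr)
  simp only [π.pt_zero, π.pt_last, ← hW] at h
  rw [le_div_iff₀ hfac] at hπ
  linarith

end Growth

/-- A path of small norm is dominated by `δ`, one of large norm by its `p`-th power. -/
lemma le_add_rpow_div {p x δ : ℝ} (hp : 1 ≤ p) (hx : 0 ≤ x) (hδ : 0 < δ) :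
    x ≤ δ + 1 / δ ^ (p - 1) * x ^ p := by
  have hδp : 0 < δ ^ (p - 1) := Real.rpow_pos_of_pos hδ _
  rcases le_or_gt x δ with h | h
  · have : 0 ≤ 1 / δ ^ (p - 1) * x ^ p := by positivity
    linarith
  · have hx0 : 0 < x := hδ.trans h
    have h1 : δ ^ (p - 1) * x ≤ x ^ p := by
      calc δ ^ (p - 1) * x ≤ x ^ (p - 1) * x := by gcongr
        _ = x ^ p := by rw [← Real.rpow_add_one hx0.ne', sub_add_cancel]
    have h2 : x ≤ 1 / δ ^ (p - 1) * x ^ p := by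
      rw [one_div_mul_eq_div, le_div_iff₀ hδp]
      linarith
    linarith

/-- The growth exponent is at most `δ + max {‖C‖, ‖C‖ ^ p} κ`. The term `‖C‖ * |||ω|||` is traded
for `δ` and a `p`-th power; the bound on the variation of `y` is at most
`G * (t + |||ω||| + |||ω||| ^ p)`. -/
lemma growth_exponent_le {p q δ t : ℝ} (hp : 1 ≤ p) (hθ : 1 < 1 / p + 1 / q) {d : ℕ}
    (A C : Matrix (Fin d) (Fin d) ℝ) (ω : ℝ → ℝ) (hδ : 0 < δ) (ht : 0 ≤ t) :
    ‖C‖ * pVar p ω 0 t +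
      2 * ‖C‖ * constK p q * ((2 * (2 * ‖A‖ * t + 2 * ‖C‖ * pVar p ω 0 t) +
        2 * (2 * (4 * ‖C‖) * constK p q * pVar p ω 0 t) ^ p) * pVar p ω 0 t) ≤
      δ + max ‖C‖ (‖C‖ ^ p) * kappa p q δ A C ω t := by
  unfold kappa
  set G := constG p q A C
  set W := pVar p ω 0 t
  set K := constK p q
  have hW : 0 ≤ W := ENNReal.toReal_nonneg
  have hK1 : 1 ≤ K := constK_ge_one hθ
  have hC : 0 ≤ ‖C‖ := norm_nonneg C
  have hA : 0 ≤ ‖A‖ := norm_nonneg A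
  have hWp : 0 ≤ W ^ p := by positivity
  have g1 : 8 * ‖A‖ ≤ G := (le_max_left _ _).trans (le_max_left _ _)
  have g2 : 16 * K * ‖C‖ ≤ G := (le_max_right _ _).trans (le_max_left _ _)
  have g3 : (16 : ℝ) ^ p * K ^ p * ‖C‖ ^ p ≤ G := (le_max_right _ _).trans (le_max_right _ _)
  have hG0 : 0 ≤ G := le_trans (by positivity) g1
  have g4 : 4 * ‖C‖ ≤ G := by nlinarith
  have g5 : 2 * (2 * (4 * ‖C‖) * K * W) ^ p ≤ G * W ^ p := by
    have h1 : (2 : ℝ) ≤ 2 ^ p := by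
      simpa using Real.rpow_le_rpow_of_exponent_le one_le_two hp
    have h2 : (2 : ℝ) ^ p * (2 * (4 * ‖C‖) * K * W) ^ p =
        (16 : ℝ) ^ p * K ^ p * ‖C‖ ^ p * W ^ p := by
      rw [← Real.mul_rpow (by norm_num) (by positivity), ← Real.mul_rpow (by norm_num)
        (by positivity), ← Real.mul_rpow (by positivity) hC, ← Real.mul_rpow (by positivity) hW]
      congr 1; ring
    calc 2 * (2 * (4 * ‖C‖) * K * W) ^ p ≤ 2 ^ p * (2 * (4 * ‖C‖) * K * W) ^ p := by gcongr
      _ ≤ G * W ^ p := by rw [h2]; gcongr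
  have h1 : 2 * (2 * ‖A‖ * t + 2 * ‖C‖ * W) + 2 * (2 * (4 * ‖C‖) * K * W) ^ p ≤
      G * (t + W + W ^ p) := by
    have e1 := mul_le_mul_of_nonneg_right g1 ht
    have e2 := mul_le_mul_of_nonneg_right g4 hW
    have e3 : 0 ≤ ‖A‖ * t := by positivity
    linarith
  have h2 : ‖C‖ * W ≤ δ + 1 / δ ^ (p - 1) * (‖C‖ ^ p * W ^ p) := by
    rw [← Real.mul_rpow hC hW]
    exact le_add_rpow_div hp (by positivity) hδ
  have h3 : ‖C‖ ^ p * (1 / δ ^ (p - 1) * W ^ p) ≤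
      max ‖C‖ (‖C‖ ^ p) * (1 / δ ^ (p - 1) * W ^ p) := by
    gcongr; exact le_max_right _ _
  have h4 : 2 * ‖C‖ * K * ((2 * (2 * ‖A‖ * t + 2 * ‖C‖ * W) +
      2 * (2 * (4 * ‖C‖) * K * W) ^ p) * W) ≤
      max ‖C‖ (‖C‖ ^ p) * (4 * K * G * W * (t + W + W ^ p)) := by
    calc _ ≤ 2 * ‖C‖ * K * (G * (t + W + W ^ p) * W) := by gcongr
      _ ≤ 4 * ‖C‖ * K * (G * (t + W + W ^ p) * W) := by gcongr; norm_num
      _ = ‖C‖ * (4 * K * G * W * (t + W + W ^ p)) := by ring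
      _ ≤ _ := by gcongr; exact le_max_left _ _
  rw [mul_add]
  linarith

/-- A growth bound that holds on intervals without zeros holds on `[0, t]`: a solution with a zero
would have a last zero before `t`, and the bound started just after it forces `X t = 0`. -/
lemma norm_le_of_growth_bound_of_ne_zero {E : Type*} [NormedAddCommGroup E] {X : ℝ → E}
    {t hA B : ℝ} (ht : 0 ≤ t) (hB : 0 ≤ B)
    (hXc : ContinuousOn X (Set.Icc 0 t))
    (h : ∀ a, 0 ≤ a → a < t → (∀ s ∈ Set.Icc a t, X s ≠ 0) →
      ‖X t‖ ≤ ‖X a‖ * Real.exp (-hA * (t - a) + B)) :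
    ‖X t‖ ≤ ‖X 0‖ * Real.exp (-hA * t + B) := by
  rcases ht.eq_or_lt with rfl | ht'
  · rw [mul_zero, zero_add]
    exact le_mul_of_one_le_right (norm_nonneg _) (Real.one_le_exp hB)
  by_cases hz : ∃ s ∈ Set.Icc 0 t, X s = 0
  · suffices hXt : X t = 0 by
      rw [hXt, norm_zero]; positivity
    have hcomp : IsCompact (Set.Icc 0 t ∩ X ⁻¹' {0}) :=
      isCompact_Icc.of_isClosed_subset (hXc.preimage_isClosed_of_isClosed isClosed_Icc
        isClosed_singleton) Set.inter_subset_left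
    obtain ⟨s, ⟨hs, hXs⟩, hmax⟩ := hcomp.exists_isGreatest
      (let ⟨s, hs, hXs⟩ := hz; ⟨s, hs, hXs⟩)
    rcases hs.2.eq_or_lt with rfl | hst
    · exact hXs
    have hev : ∀ᶠ u in nhdsWithin s (Set.Ioc s t),
        ‖X t‖ ≤ ‖X u‖ * Real.exp (-hA * (t - u) + B) := by
      have hlt : ∀ᶠ u in nhdsWithin s (Set.Ioc s t), u < t :=
        nhdsWithin_le_nhds (Iio_mem_nhds hst)
      filter_upwards [self_mem_nhdsWithin, hlt] with u hu hut
      refine h u (hs.1.trans hu.1.le) hut fun r hr hXr => ?_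
      have : r ≤ s := hmax ⟨⟨hs.1.trans (hu.1.le.trans hr.1), hr.2⟩, hXr⟩
      linarith [hu.1, hr.1]
    have hlim : Filter.Tendsto (fun u => ‖X u‖ * Real.exp (-hA * (t - u) + B))
        (nhdsWithin s (Set.Ioc s t)) (nhds (‖X s‖ * Real.exp (-hA * (t - s) + B))) := by
      refine Filter.Tendsto.mul ?_ ?_
      · exact ((hXc s hs).mono fun u hu => ⟨hs.1.trans hu.1.le, hu.2⟩).norm
      · exact Continuous.continuousWithinAt (f := fun u => Real.exp (-hA * (t - u) + B))
          (by fun_prop)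
    have : (nhdsWithin s (Set.Ioc s t)).NeBot := by
      rw [nhdsWithin_Ioc_eq_nhdsGT hst]; infer_instance
    have hle := ge_of_tendsto hlim hev
    rw [Set.mem_preimage, Set.mem_singleton_iff] at hXs
    rw [hXs, norm_zero, zero_mul] at hle
    exact norm_le_zero_iff.1 hle
  · have := h 0 le_rfl ht' fun s hs hXs => hz ⟨s, hs, hXs⟩
    rwa [sub_zero] at this

/-! ### The fundamental matrix -/

section Matrix

variable {d : ℕ}

/-- Application of a matrix to a fixed vector, as a continuous linear map in the matrix. -/
noncomputable def applyCLM (x : EuclideanSpace ℝ (Fin d)) :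
    Matrix (Fin d) (Fin d) ℝ →L[ℝ] EuclideanSpace ℝ (Fin d) :=
  LinearMap.mkContinuous
    { toFun := fun M => Matrix.toEuclideanCLM (𝕜 := ℝ) M x
      map_add' := fun M N => by simp
      map_smul' := fun c M => by simp } ‖x‖ fun M => by
    rw [mul_comm]
    exact (Matrix.toEuclideanCLM (𝕜 := ℝ) M).le_opNorm x

lemma applyCLM_mul (x : EuclideanSpace ℝ (Fin d)) (M N : Matrix (Fin d) (Fin d) ℝ) :
    applyCLM x (M * N) = Matrix.toEuclideanCLM (𝕜 := ℝ) M (applyCLM x N) := by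
  change Matrix.toEuclideanCLM (𝕜 := ℝ) (M * N) x = _
  rw [map_mul]
  rfl

lemma norm_applyCLM_le (x : EuclideanSpace ℝ (Fin d)) (M : Matrix (Fin d) (Fin d) ℝ) :
    ‖applyCLM x M‖ ≤ ‖x‖ * ‖M‖ := by
  rw [mul_comm]
  exact (Matrix.toEuclideanCLM (𝕜 := ℝ) M).le_opNorm x

/-- The columns of the fundamental matrix solve the linear Young equation. -/
lemma IsFundamentalMatrix.hasIntegral_apply {q T : ℝ} {A C : Matrix (Fin d) (Fin d) ℝ} {ω : ℝ → ℝ}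
    {Φ : ℝ → Matrix (Fin d) (Fin d) ℝ} (hΦ : IsFundamentalMatrix q T A C ω Φ)
    (x : EuclideanSpace ℝ (Fin d)) {t : ℝ} (ht : t ∈ Set.Icc 0 T) :
    HasIntegral (fun s => Matrix.toEuclideanCLM (𝕜 := ℝ) C (applyCLM x (Φ s))) ω 0 t
      (applyCLM x (Φ t) - applyCLM x (Φ 0) -
        ∫ s in (0 : ℝ)..t, Matrix.toEuclideanCLM (𝕜 := ℝ) A (applyCLM x (Φ s))) := by
  have h := (hΦ.eqn t ht).map (applyCLM x)
  have hint : IntervalIntegrable (fun s => A * Φ s) MeasureTheory.volume 0 t := by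
    refine ContinuousOn.intervalIntegrable ?_
    rw [Set.uIcc_of_le ht.1]
    exact continuousOn_const.mul (hΦ.memCPVar.1.mono (Set.Icc_subset_Icc le_rfl ht.2))
  rw [map_sub, map_sub, ← ContinuousLinearMap.intervalIntegral_comp_comm _ hint] at h
  simpa only [applyCLM_mul] using h

end Matrix

end Young

theorem corollary3p3 {d : ℕ} (p q T : ℝ) (hp1 : 1 < p) (hp2 : p < 2) (hpq : p ≤ q)
    (hθ : 1 < 1 / p + 1 / q) (hT : 0 < T)
    (ω : ℝ → ℝ) (hω : Young.MemCPVar p ω 0 T)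
    (A C : Matrix (Fin d) (Fin d) ℝ) (h_A : ℝ) (h_A_pos : 0 < h_A)
    (hA : ∀ x : EuclideanSpace ℝ (Fin d),
      inner ℝ x (Matrix.toEuclideanCLM (𝕜 := ℝ) A x) ≤ -h_A * ‖x‖ ^ 2)
    (Φ : ℝ → Matrix (Fin d) (Fin d) ℝ) (hΦ : Young.IsFundamentalMatrix q T A C ω Φ)
    (δ : ℝ) (hδ : 0 < δ) :
    ∀ t ∈ Set.Icc (0 : ℝ) 1, t ≤ T →
      ‖Φ t‖ ≤ Real.exp (-h_A * t + δ + max ‖C‖ (‖C‖ ^ p) * Young.kappa p q δ A C ω t) := by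
  open Young in
  intro t ht htT
  have ht0 : 0 ≤ t := ht.1
  have hp0 : 0 < p := by linarith
  have hK : 0 ≤ constK p q := zero_le_one.trans (constK_ge_one hθ)
  have hexp := growth_exponent_le hp1.le hθ A C ω hδ ht0
  have hW0 : 0 ≤ pVar p ω 0 t := ENNReal.toReal_nonneg
  have hB := le_trans (by positivity) hexp
  have hctl := isPControl_pVar (by linarith : 0 < q) hΦ.memCPVar.2
  rw [add_assoc, ← Matrix.l2_opNorm_toEuclideanCLM]
  refine ContinuousLinearMap.opNorm_le_bound _ (Real.exp_nonneg _) fun x => ?_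
  have hXc : ContinuousOn (fun s => applyCLM x (Φ s)) (Set.Icc 0 T) :=
    (applyCLM x).continuous.comp_continuousOn hΦ.memCPVar.1
  have hmain := norm_le_of_growth_bound_of_ne_zero (X := fun s => applyCLM x (Φ s)) (hA := h_A)
    ht0 hB (hXc.mono (Set.Icc_subset_Icc le_rfl htT)) (fun a ha hat hne => by
      have hlog := log_norm_sub_le hp1 hp2 hpq hθ hω hA hXc (hctl.const_mul (norm_nonneg x))
        (fun u hu v hv huv => by
          rw [← map_sub]
          exact (norm_applyCLM_le x _).trans (mul_le_mul_of_nonneg_left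
            (norm_sub_le_pVar (by linarith) hΦ.memCPVar.2 hu.1 huv hv.2) (norm_nonneg x)))
        (fun s hs => hΦ.hasIntegral_apply x hs) ha hat htT hne
      -- the variation over `[a, t]` is dominated by the one over `[0, t]`
      have hWle : pVar p ω a t ≤ pVar p ω 0 t := (isPControl_pVar hp0 hω.2).mono_left hp0
        ⟨le_rfl, hT.le⟩ ⟨ha, by linarith⟩ ⟨ht0, htT⟩ ha hat.le
      have hWa0 : 0 ≤ pVar p ω a t := ENNReal.toReal_nonneg
      have hta : t - a ≤ t := by linarith
      have hta0 : 0 ≤ t - a := by linarith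
      have hmono : ‖C‖ * pVar p ω a t +
          2 * ‖C‖ * constK p q * ((2 * (2 * ‖A‖ * (t - a) + 2 * ‖C‖ * pVar p ω a t) +
          2 * (2 * (4 * ‖C‖) * constK p q * pVar p ω a t) ^ p) * pVar p ω a t) ≤
          ‖C‖ * pVar p ω 0 t +
          2 * ‖C‖ * constK p q * ((2 * (2 * ‖A‖ * t + 2 * ‖C‖ * pVar p ω 0 t) +
          2 * (2 * (4 * ‖C‖) * constK p q * pVar p ω 0 t) ^ p) * pVar p ω 0 t) := by
        gcongr
      rw [Matrix.l2_opNorm_toEuclideanCLM, Matrix.l2_opNorm_toEuclideanCLM] at hlog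
      have hXa : 0 < ‖applyCLM x (Φ a)‖ := norm_pos_iff.2 (hne a ⟨le_rfl, hat.le⟩)
      have hXt : 0 < ‖applyCLM x (Φ t)‖ := norm_pos_iff.2 (hne t ⟨hat.le, le_rfl⟩)
      rw [← Real.log_le_log_iff hXt (by positivity), Real.log_mul hXa.ne' (Real.exp_ne_zero _),
        Real.log_exp]
      linarith)
  have h0 : applyCLM x (Φ 0) = x := by
    rw [hΦ.init]
    change Matrix.toEuclideanCLM (𝕜 := ℝ) 1 x = x
    rw [map_one]
    rfl
  simp only [h0] at hmain
  rw [mul_comm]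
  exact hmain
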